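/- Let $d\ge 1$, $T>0$, let $\Omega\subset\mathbb R^d$ be open, let $p\in C(\mathbb R)$ with $p(0)=0$, and let $\rho\ge 0$, $\rho\in L^\infty((0,T)\times\Omega)$, $u\in L^\infty((0,T)\times\Omega;\mathbb R^d)$ be a weak (distributional) solution on $(0,T)\times\Omega$ of the isentropic compressible Euler system $$\partial_t(\rho u)+\operatorname{div}(\rho u\otimes u)+\nabla p(\rho)=\rho f,\qquad \partial_t\rho+\operatorname{div}(\rho u)=0,$$ with external force $f\in L^1((0,T)\times\Omega;\mathbb R^d)$. Assume that the distributions $\partial_t\rho$ and $\partial_t(\rho u)$ are (locally finite, real- resp. $\mathbb R^d$-valued) Radon measures on $(0,T)\times\Omega$ and disintegrate in time as $\partial_t\rho=\mu_t\otimes dt$, $\partial_t(\rho u)=\nu_t\otimes dt$, with Radon measures $\mu_t$, $\nu_t$ on $\Omega$; here $\mu=\mu_t\otimes dt$ means $\int\varphi\,d\mu=\int_0^T\int_\Omega\varphi(t,\cdot)\,d\mu_t\,dt$ for all $\varphi\in C_c((0,T)\times\Omega)$, the function $t\mapsto\int_\Omega\varphi(t,\cdot)\,d\mu_t$ being integrable.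 Assume that for a.e. $t\in(0,T)$ one has $\mu_t(\Sigma)=0$ and $\nu_t(\Sigma)=0$ for every Lipschitz hypersurface $\Sigma\subset\Omega$ (for which these values are defined, that is, which has finite total variation measure). Terminology. A Lipschitz hypersurface is a set that near each of its points is the graph of a Lipschitz function over a hyperplane. A unit normal of $\Sigma$ is a field $n$ such that for $\mathcal H^{d-1}$-a.e. $x\in\Sigma$, $|n(x)|=1$ and $\langle y-x,n(x)\rangle=o(|y-x|)$ as $\Sigma\ni y\to x$. A function $g$ has one-sided limits $g^\pm$ at $x$ along a unit vector $n$ if $\lim_{\ell\to0^+}\int_{\{|z|<1,\ \pm\langle z,n\rangle\ge 0\}}|g(x+\ell z)-g^\pm|\,dz=0$. A scalar function $g$ has bilateral traces at $\Sigma$ if $\mathcal H^{d-1}$-a.e. $x\in\Sigma$ is a Lebesgue point ($\int_{B_1}|g(x+\ell z)-c|\,dz\to0$ for some constant $c$) or a jump point ($g$ has one-sided limits $g^+\neq g^-$ at $x$ along some unit vector) of $g$; a vector field has bilateral traces at $\Sigma$ if each of its components does. Then the following holds for a.e. $t\in(0,T)$. Let $\Sigma\subset\Omega$ be a Lipschitz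 hypersurface oriented by a unit normal $n$ such that both $\rho_t=\rho(t,\cdot)$ and $u_t=u(t,\cdot)$ have bilateral traces at $\Sigma$. Then for $\mathcal H^{d-1}$-a.e. $x\in\Sigma$ the one-sided limits $\rho_t^\pm$, $u_t^\pm$ of $\rho_t$, $u_t$ at $x$ along $n(x)$ exist and, with $(u_t^\pm)_n=u_t^\pm\cdot n(x)$, $$\big((u_t^+)_n-(u_t^-)_n\big)\Big[\rho_t^+\rho_t^-\,|u_t^+-u_t^-|^2-\big(p(\rho_t^+)-p(\rho_t^-)\big)(\rho_t^+-\rho_t^-)\Big]=0 .$$ -/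

import Mathlib

open MeasureTheory Filter Topology TopologicalSpace Set
open scoped Distributions ENNReal NNReal RealInnerProductSpace

noncomputable section

namespace IsentropicEuler

/-- The Euclidean space `ℝ^d`. -/
abbrev Space (d : ℕ) : Type := EuclideanSpace ℝ (Fin d)

/-- The open space-time cylinder `(0,T) × Ω`. -/
def cylinder {d : ℕ} (T : ℝ) (Ω : Opens (Space d)) : Opens (ℝ × Space d) :=
  ⟨Ioo 0 T ×ˢ (Ω : Set (Space d)), isOpen_Ioo.prod Ω.isOpen⟩

/-! ### Radon measures with values in a normed space -/

/-- An `F`-valued Radon measure (locally finite Borel measure) on the open set `U`, written in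
polar form: its total variation, a positive Borel measure carried by `U` and finite on the compact
subsets of `U`, together with a density of norm one. For `F = ℝ` these are the signed Radon
measures. The total variation of all of `U` may be infinite. -/
structure RadonMeasure {X : Type*} [TopologicalSpace X] [MeasurableSpace X] (U : Opens X)
    (F : Type*) [NormedAddCommGroup F] where
  variation : Measure X
  direction : X → F
  variation_compl : variation (U : Set X)ᶜ = 0
  variation_lt_top : ∀ K : Set X, IsCompact K → K ⊆ U → variation K < ∞
  stronglyMeasurable_direction : StronglyMeasurable direction
  norm_direction : ∀ᵐ x ∂variation, ‖direction x‖ = 1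

namespace RadonMeasure

variable {X : Type*} [TopologicalSpace X] [MeasurableSpace X] {U : Opens X}
  {F : Type*} [NormedAddCommGroup F] [NormedSpace ℝ F]

/-- The integral `∫ φ dμ` of a scalar function. -/
def integral (μ : RadonMeasure U F) (φ : X → ℝ) : F :=
  ∫ x, φ x • μ.direction x ∂μ.variation

/-- `μ(S) = 0`. The value `μ(S)` of a locally finite signed or vector measure makes sense only on
sets of finite total variation, so nothing is required of the other sets. -/
def VanishesOn (μ : RadonMeasure U F) (S : Set X) : Prop :=
  μ.variation S < ∞ → ∫ x in S, μ.direction x ∂μ.variation = 0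

end RadonMeasure

/-! ### Distributional derivatives, weak solutions, disintegration in time -/

section Equations

variable {d : ℕ}

/-- The time derivative of a function on space-time. -/
def timeDeriv (φ : ℝ × Space d → ℝ) (q : ℝ × Space d) : ℝ :=
  deriv (fun s => φ (s, q.2)) q.1

/-- The gradient in the space variable of a function on space-time. -/
def spaceGrad (φ : ℝ × Space d → ℝ) (q : ℝ × Space d) : Space d :=
  gradient (fun y => φ (q.1, y)) q.2

/-- `(ρ, u)` is a bounded weak (distributional) solution on `(0,T) × Ω` of
`∂ₜ(ρu) + div(ρ u ⊗ u) + ∇ p(ρ) = ρ f`, `∂ₜρ + div(ρu) = 0`, with nonnegative density and with an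
integrable force. The momentum balance is a vector identity, tested by scalar functions. -/
structure IsBoundedWeakSolution (T : ℝ) (Ω : Opens (Space d)) (p : ℝ → ℝ)
    (ρ : ℝ → Space d → ℝ) (u f : ℝ → Space d → Space d) : Prop where
  density_memLp : MemLp (fun q : ℝ × Space d => ρ q.1 q.2) ∞
    (volume.restrict (cylinder T Ω : Set (ℝ × Space d)))
  velocity_memLp : MemLp (fun q : ℝ × Space d => u q.1 q.2) ∞
    (volume.restrict (cylinder T Ω : Set (ℝ × Space d)))
  force_memLp : MemLp (fun q : ℝ × Space d => f q.1 q.2) 1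
    (volume.restrict (cylinder T Ω : Set (ℝ × Space d)))
  density_nonneg : ∀ᵐ q ∂(volume.restrict (cylinder T Ω : Set (ℝ × Space d))), 0 ≤ ρ q.1 q.2
  continuity : ∀ φ : 𝓓(cylinder T Ω, ℝ),
    ∫ q in (cylinder T Ω : Set (ℝ × Space d)),
      (ρ q.1 q.2 * timeDeriv φ q + ρ q.1 q.2 * ⟪u q.1 q.2, spaceGrad φ q⟫) = 0
  momentum : ∀ φ : 𝓓(cylinder T Ω, ℝ),
    ∫ q in (cylinder T Ω : Set (ℝ × Space d)),
      ((timeDeriv φ q * ρ q.1 q.2) • u q.1 q.2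
        + (ρ q.1 q.2 * ⟪u q.1 q.2, spaceGrad φ q⟫) • u q.1 q.2
        + p (ρ q.1 q.2) • spaceGrad φ q
        + (φ q * ρ q.1 q.2) • f q.1 q.2) = 0

variable {F : Type*} [NormedAddCommGroup F] [NormedSpace ℝ F]

/-- `∂ₜ g = μ` in the sense of distributions on `(0,T) × Ω`. -/
def IsTimeDerivative (T : ℝ) (Ω : Opens (Space d)) (g : ℝ → Space d → F)
    (μ : RadonMeasure (cylinder T Ω) F) : Prop :=
  ∀ φ : 𝓓(cylinder T Ω, ℝ),
    -∫ q in (cylinder T Ω : Set (ℝ × Space d)), timeDeriv φ q • g q.1 q.2 = μ.integral φ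

/-- `μ = μₜ ⊗ dt`, tested against continuous functions with compact support in `(0,T) × Ω`. -/
def DisintegratesInTime (T : ℝ) (Ω : Opens (Space d)) (μ : RadonMeasure (cylinder T Ω) F)
    (μt : ℝ → RadonMeasure Ω F) : Prop :=
  ∀ φ : 𝓓^{0}(cylinder T Ω, ℝ),
    IntegrableOn (fun t => (μt t).integral fun x => φ (t, x)) (Ioo 0 T) ∧
      μ.integral φ = ∫ t in Ioo 0 T, (μt t).integral fun x => φ (t, x)

end Equations

/-! ### Lipschitz hypersurfaces and their unit normals -/

section Hypersurfaces

variable {d : ℕ}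

/-- `S` is a Lipschitz hypersurface: near each of its points it is the graph of a Lipschitz
function over the hyperplane orthogonal to some unit vector `ν`. The function `g` is evaluated at
points of this hyperplane only. -/
def IsLipschitzHypersurface (S : Set (Space d)) : Prop :=
  ∀ x ∈ S, ∃ U : Set (Space d), IsOpen U ∧ x ∈ U ∧
    ∃ ν : Space d, ‖ν‖ = 1 ∧ ∃ (K : ℝ≥0) (g : Space d → ℝ), LipschitzWith K g ∧
      ∀ y ∈ U, y ∈ S ↔ ⟪ν, y⟫ = g (y - ⟪ν, y⟫ • ν)

/-- The Hausdorff measure of dimension `d - 1` on `ℝ^d`. -/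
def surfaceMeasure (d : ℕ) : Measure (Space d) := Measure.hausdorffMeasure ((d : ℝ) - 1)

/-- `n` is a unit normal vector field of the hypersurface `S`: at almost every point `x` of `S`,
`n x` is a unit vector orthogonal to the tangent hyperplane, that is,
`⟨y - x, n x⟩ = o(|y - x|)` as `y → x` in `S`. -/
def IsUnitNormal (S : Set (Space d)) (n : Space d → Space d) : Prop :=
  ∀ᵐ x ∂surfaceMeasure d, x ∈ S → ‖n x‖ = 1 ∧
    (fun y => ⟪y - x, n x⟫) =o[𝓝[S] x] (fun y => y - x)

end Hypersurfaces

/-! ### Blow-ups and traces -/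

section Traces

variable {d : ℕ} {F : Type*} [NormedAddCommGroup F]

/-- `v` is the blow-up of `g` at `x`: `∫_{B₁} |g(x + ℓz) - v(z)| dz → 0` as `ℓ → 0⁺`. -/
def IsBlowUp (g : Space d → F) (x : Space d) (v : Space d → F) : Prop :=
  Tendsto (fun ℓ : ℝ => ∫⁻ z in Metric.ball (0 : Space d) 1, ‖g (x + ℓ • z) - v z‖ₑ)
    (𝓝[>] 0) (𝓝 0)

open Classical in
/-- The function with value `a` on `{⟨z,n⟩ ≥ 0}` and `b` on `{⟨z,n⟩ < 0}`. -/
def jumpProfile (a b : F) (n : Space d) (z : Space d) : F :=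
  if 0 ≤ ⟪z, n⟫ then a else b

/-- `x` is a Lebesgue point: `g` has a constant blow-up at `x`. -/
def IsLebesguePoint (g : Space d → F) (x : Space d) : Prop :=
  ∃ c : F, IsBlowUp g x fun _ => c

/-- `x` is a jump point of `g`. -/
def IsJumpPoint (g : Space d → F) (x : Space d) : Prop :=
  ∃ (a b : F) (n : Space d), ‖n‖ = 1 ∧ a ≠ b ∧ IsBlowUp g x (jumpProfile a b n)

/-- The scalar function `g` has bilateral traces at `S`: almost every point of `S` is a Lebesgue
point or a jump point of `g`. The direction of the jump is not prescribed. -/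
def HasBilateralTraces (g : Space d → ℝ) (S : Set (Space d)) : Prop :=
  ∀ᵐ x ∂surfaceMeasure d, x ∈ S → IsLebesguePoint g x ∨ IsJumpPoint g x

/-- The vector field `v` has bilateral traces at `S`: almost every point of `S` is, for each
component of `v`, a Lebesgue point or a jump point. -/
def HasBilateralTracesVec (v : Space d → Space d) (S : Set (Space d)) : Prop :=
  ∀ᵐ x ∂surfaceMeasure d, x ∈ S →
    ∀ i : Fin d, IsLebesguePoint (fun y => v y i) x ∨ IsJumpPoint (fun y => v y i) x

/-- `gp` and `gm` are the one-sided Lebesgue limits of `g` at `x` along the direction `n`, from the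
sides `{⟨z,n⟩ ≥ 0}` and `{⟨z,n⟩ ≤ 0}`. -/
def HasOneSidedLimits (g : Space d → F) (x n : Space d) (gp gm : F) : Prop :=
  IsBlowUp g x (jumpProfile gp gm n)

/-- The function `Γ(a, b, v, w) = a b |v - w|² - (p(a) - p(b)) (a - b)`. -/
def Gam (p : ℝ → ℝ) (a b : ℝ) (v w : Space d) : ℝ :=
  a * b * ‖v - w‖ ^ 2 - (p a - p b) * (a - b)

end Traces

end IsentropicEuler

end

/-!
At almost every time `t` the two balance laws of the Euler system become stationary equations
`-div W + h = λ` on `Ω`, with a bounded flux `W` (a continuous function of the state `(ρ, u)`), an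
integrable source `h`, and the Radon measure `λ = μₜ` or `λ = νₜ`. At almost every point `x` of a
hypersurface `S`, the equation is blown up.

* A hypersurface is a countable union of relatively open pieces of finite variation, which are again
  hypersurfaces; so the hypothesis forces `|λ|(S) = 0`
  (`RadonMeasure.variation_eq_zero_of_vanishesOn`). A Vitali covering argument then shows that `λ`
  and `h dx` have zero `(d-1)`-dimensional density at `ℋ^{d-1}`-almost every point of `S`
  (`ae_tendsto_density_zero`).
* Where the densities vanish, testing the equation with `φ((· - x)/ℓ)` and letting `ℓ → 0` gives
  `∫ W₀ ∇φ = 0` for the blow-up `W₀` of `W`, hence `W⁺ n = W⁻ n` (`jump_relation`). One radial `φ`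
  suffices: by symmetry the integral of `∇φ` over the half-space `{⟨z, n⟩ ≥ 0}` is a nonzero
  multiple of `n` (`setIntegral_radialBumpGrad_halfSpace`). Since only the translates and rescalings
  of one function are used, the exceptional set of times can be chosen independently of the test
  function (`ae_balance_law_radialBump`).
* The one-sided limits exist along the normal of `S` because almost every jump of a function `g` at
  `S` occurs in the normal direction (`ae_jump_direction`). Points of `S` where `g` has similar jump
  profiles, seen at a common range of scales, lie in a thin double cone around the hyperplane
  orthogonal to the jump (`abs_inner_le_of_similar_jumps`), whereas almost every point of any subset
  `A` of `S` has the whole tangent hyperplane of `S` as tangent directions of `A`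
  (`IsLipschitzHypersurface.ae_mem_tangentConeAt`).
* Applied to the fluxes of mass and of momentum, the jump relation gives `[ρ uₙ] = 0` and
  `ρ uₙ [u] + [p] n = 0`; the scalar product of the latter with `[u]` and elementary algebra yield
  the claim (`jump_mul_gam_eq_zero`).
-/

namespace IsentropicEuler

/-! ### Densities of measures on Lipschitz hypersurfaces -/

section Density

variable {X : Type*} [MetricSpace X] [MeasurableSpace X] [BorelSpace X]

/-- A set of points where `lam` has upper `s`-dimensional density larger than `c` is covered, at
every scale, by enlargements of disjoint balls of large mass, by Vitali's lemma. -/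
theorem hausdorffMeasure_le_of_large_density [SeparableSpace X]
    (lam : Measure X) {s : ℝ} (hs : 0 ≤ s) {c : ℝ≥0∞} (hc : c ≠ 0) (hc' : c ≠ ∞) {A V : Set X}
    (hV : IsOpen V) (hAV : A ⊆ V)
    (hA : ∀ x ∈ A, ∃ᶠ r in 𝓝[>] (0 : ℝ), c * ENNReal.ofReal r ^ s < lam (Metric.closedBall x r)) :
    Measure.hausdorffMeasure s A ≤ ENNReal.ofReal 8 ^ s * c⁻¹ * lam V := by
  set t : ℕ → Set (X × ℝ) := fun n => {q | q.1 ∈ A ∧ 0 < q.2 ∧ q.2 ≤ 1 / ((n : ℝ) + 1) ∧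
    Metric.closedBall q.1 q.2 ⊆ V ∧ c * ENNReal.ofReal q.2 ^ s < lam (Metric.closedBall q.1 q.2)}
    with ht
  have hVit : ∀ n, ∃ v ⊆ t n, (v.PairwiseDisjoint fun q => Metric.closedBall q.1 q.2) ∧
      ∀ a ∈ t n, ∃ b ∈ v, Metric.closedBall a.1 a.2 ⊆ Metric.closedBall b.1 (4 * b.2) := fun n =>
    Vitali.exists_disjoint_subfamily_covering_enlargement_closedBall (t n) Prod.fst Prod.snd
      (1 / ((n : ℝ) + 1)) (fun a ha => ha.2.2.1) 4 (by norm_num)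
  choose v hvt hvd hcov using hVit
  have hcount : ∀ n, (v n).Countable := fun n => by
    refine (hvd n).countable_of_nonempty_interior fun q hq => ⟨q.1, ?_⟩
    exact Metric.ball_subset_interior_closedBall (Metric.mem_ball_self (hvt n hq).2.1)
  have : ∀ n, Countable (v n) := fun n => (hcount n).to_subtype
  have hr : Tendsto (fun n : ℕ => ENNReal.ofReal (8 * (1 / ((n : ℝ) + 1)))) atTop (𝓝 0) := by
    rw [← ENNReal.ofReal_zero]
    refine ENNReal.tendsto_ofReal ?_
    simpa using tendsto_one_div_add_atTop_nhds_zero_nat.const_mul (8 : ℝ)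
  have hdiam : ∀ q : X × ℝ, 0 < q.2 →
      Metric.ediam (Metric.closedBall q.1 (4 * q.2)) ≤ ENNReal.ofReal 8 * ENNReal.ofReal q.2 := by
    intro q hq
    rw [← Metric.closedEBall_ofReal (by positivity)]
    refine Metric.ediam_closedEBall_le.trans (le_of_eq ?_)
    rw [← ENNReal.ofReal_mul (by norm_num), show (2 : ℝ≥0∞) = ENNReal.ofReal 2 by simp,
      ← ENNReal.ofReal_mul (by norm_num)]
    congr 1; ring
  have key := Measure.hausdorffMeasure_le_liminf_tsum s A (l := atTop) _ hr
    (fun n (q : v n) => Metric.closedBall q.1.1 (4 * q.1.2))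
    (Eventually.of_forall fun n q => (hdiam _ (hvt n q.2).2.1).trans (by
      rw [ENNReal.ofReal_mul (by norm_num)]
      gcongr
      exact (hvt n q.2).2.2.1))
    (Eventually.of_forall fun n x hx => by
      have hev : ∀ᶠ r in 𝓝[>] (0 : ℝ), 0 < r ∧ r ≤ 1 / ((n : ℝ) + 1) ∧
          Metric.closedBall x r ⊆ V := by
        obtain ⟨ε, hε, hb⟩ := Metric.isOpen_iff.1 hV x (hAV hx)
        have h1 : (0 : ℝ) < 1 / ((n : ℝ) + 1) := by positivity
        filter_upwards [Ioo_mem_nhdsGT (lt_min hε h1)] with r hr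
        exact ⟨hr.1, (hr.2.trans_le (min_le_right _ _)).le,
          (Metric.closedBall_subset_ball (hr.2.trans_le (min_le_left _ _))).trans hb⟩
      obtain ⟨r, hr1, hr2⟩ := ((hA x hx).and_eventually hev).exists
      obtain ⟨b, hb, hsub⟩ := hcov n (x, r) ⟨hx, hr2.1, hr2.2.1, hr2.2.2, hr1⟩
      exact mem_iUnion.2 ⟨⟨b, hb⟩, hsub (Metric.mem_closedBall_self hr2.1.le)⟩)
  refine key.trans ?_
  refine (liminf_le_liminf (v := fun _ => ENNReal.ofReal 8 ^ s * c⁻¹ * lam V)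
    (Eventually.of_forall fun n => ?_)).trans (by simp)
  calc ∑' q : v n, Metric.ediam (Metric.closedBall q.1.1 (4 * q.1.2)) ^ s
      ≤ ∑' q : v n, ENNReal.ofReal 8 ^ s * c⁻¹ * lam (Metric.closedBall q.1.1 q.1.2) := by
        refine ENNReal.tsum_le_tsum fun q => ?_
        have hq := hvt n q.2
        calc _ ≤ (ENNReal.ofReal 8 * ENNReal.ofReal q.1.2) ^ s :=
              ENNReal.rpow_le_rpow (hdiam _ hq.2.1) hs
          _ = ENNReal.ofReal 8 ^ s * (c⁻¹ * (c * ENNReal.ofReal q.1.2 ^ s)) := by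
              rw [ENNReal.mul_rpow_of_nonneg _ _ hs, ← mul_assoc c⁻¹, ENNReal.inv_mul_cancel hc hc',
                one_mul]
          _ ≤ _ := by
              rw [mul_assoc]
              gcongr
              exact hq.2.2.2.2.le
    _ = ENNReal.ofReal 8 ^ s * c⁻¹ * lam (⋃ q ∈ v n, Metric.closedBall q.1 q.2) := by
        rw [ENNReal.tsum_mul_left, measure_biUnion (hcount n) (hvd n)
          fun q _ => Metric.isClosed_closedBall.measurableSet]
    _ ≤ _ := by
        gcongr
        exact iUnion₂_subset fun q hq => (hvt n hq).2.2.2.1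

/-- A locally finite measure which does not charge `S` has zero `s`-dimensional density at
`ℋ^s`-almost every point of `S`. -/
theorem ae_tendsto_density_zero [SecondCountableTopology X] (lam : Measure X) {s : ℝ} (hs : 0 ≤ s)
    {S : Set X} (hfin : ∀ x ∈ S, ∃ r > 0, lam (Metric.ball x r) < ∞) (hS : lam S = 0) :
    ∀ᵐ x ∂(Measure.hausdorffMeasure s : Measure X), x ∈ S →
      Tendsto (fun r : ℝ => lam (Metric.closedBall x r) / ENNReal.ofReal r ^ s) (𝓝[>] 0) (𝓝 0) := by
  set B : ℕ → Set X := fun k => {x | x ∈ S ∧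
    ∃ᶠ r in 𝓝[>] (0 : ℝ), ((k : ℝ≥0∞) + 1)⁻¹ * ENNReal.ofReal r ^ s < lam (Metric.closedBall x r)}
  have hB : ∀ k, Measure.hausdorffMeasure s (B k) = 0 := by
    intro k
    refine measure_null_of_locally_null _ fun x hx => ?_
    obtain ⟨r, hr, hlt⟩ := hfin x hx.1
    refine ⟨B k ∩ Metric.ball x r,
      inter_mem_nhdsWithin _ (Metric.ball_mem_nhds x hr), ?_⟩
    -- finite Borel measures are outer regular, so open neighbourhoods of small mass exist
    set m := lam.restrict (Metric.ball x r)
    have : IsFiniteMeasure m := ⟨by simpa [m] using hlt⟩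
    have hm : m (B k ∩ Metric.ball x r) = 0 :=
      measure_mono_null (fun y hy => hy.1.1) (Measure.restrict_le_self.absolutelyContinuous hS)
    refine le_antisymm (ENNReal.le_of_forall_pos_le_add fun ε hε _ => ?_) bot_le
    have hc : ((k : ℝ≥0∞) + 1)⁻¹ ≠ 0 := by simp
    have hc' : ((k : ℝ≥0∞) + 1)⁻¹ ≠ ∞ := by simp
    set C : ℝ≥0∞ := ENNReal.ofReal 8 ^ s * ((k : ℝ≥0∞) + 1)⁻¹⁻¹
    have hC : C ≠ ∞ := ENNReal.mul_ne_top (by finiteness) (by simp)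
    obtain ⟨δ, hδ, hCδ⟩ : ∃ δ : ℝ≥0∞, 0 < δ ∧ C * δ ≤ ε := by
      refine ⟨ε / (C + 1), ENNReal.div_pos (by exact_mod_cast hε.ne') (by finiteness), ?_⟩
      calc C * (ε / (C + 1)) ≤ (C + 1) * (ε / (C + 1)) := by gcongr; exact le_self_add
        _ ≤ ε := ENNReal.mul_div_le
    obtain ⟨V, hVs, hVo, hV⟩ := Set.exists_isOpen_lt_of_lt (μ := m) (B k ∩ Metric.ball x r) δ
      (by rwa [hm])
    refine (hausdorffMeasure_le_of_large_density m hs hc hc' hVo hVs fun y hy => ?_).trans ?_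
    · have hev : ∀ᶠ ρ in 𝓝[>] (0 : ℝ), Metric.closedBall y ρ ⊆ Metric.ball x r := by
        obtain ⟨ε', hε', hb⟩ := Metric.isOpen_iff.1 Metric.isOpen_ball y hy.2
        filter_upwards [Ioo_mem_nhdsGT hε'] with ρ hρ
        exact (Metric.closedBall_subset_ball hρ.2).trans hb
      refine (hy.1.2.and_eventually hev).mono fun ρ hρ => ?_
      rw [Measure.restrict_apply Metric.isClosed_closedBall.measurableSet,
        inter_eq_self_of_subset_left hρ.2]
      exact hρ.1
    · rw [zero_add]
      exact (mul_le_mul_right hV.le _).trans hCδ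
  have hall : ∀ᵐ x ∂(Measure.hausdorffMeasure s : Measure X), ∀ k, x ∉ B k :=
    ae_all_iff.2 fun k => measure_eq_zero_iff_ae_notMem.1 (hB k)
  filter_upwards [hall] with x hx hxS
  refine ENNReal.tendsto_nhds_zero.2 fun ε hε => ?_
  obtain ⟨k, hk⟩ := ENNReal.exists_inv_nat_lt hε.ne'
  have hnf : ∀ᶠ r in 𝓝[>] (0 : ℝ),
      ¬ ((k : ℝ≥0∞) + 1)⁻¹ * ENNReal.ofReal r ^ s < lam (Metric.closedBall x r) :=
    not_frequently.1 fun h => hx k ⟨hxS, h⟩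
  filter_upwards [hnf, self_mem_nhdsWithin] with r hr hr0
  have hr0 : 0 < r := hr0
  refine ENNReal.div_le_of_le_mul ((not_lt.1 hr).trans ?_)
  gcongr
  exact (ENNReal.inv_le_inv.2 le_self_add).trans hk.le

end Density

section Null

variable {d : ℕ}

theorem IsLipschitzHypersurface.inter_isOpen {S V : Set (Space d)}
    (hS : IsLipschitzHypersurface S) (hV : IsOpen V) : IsLipschitzHypersurface (S ∩ V) := by
  intro x hx
  obtain ⟨U, hU, hxU, ν, hν, K, g, hg, h⟩ := hS x hx.1
  exact ⟨U ∩ V, hU.inter hV, ⟨hxU, hx.2⟩, ν, hν, K, g, hg, fun y hy => by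
    rw [← h y hy.1]; exact ⟨fun h => h.1, fun h => ⟨h, hy.2⟩⟩⟩

/-- A Radon measure is finite near every point of its domain. -/
theorem RadonMeasure.exists_ball_lt_top {F : Type*} [NormedAddCommGroup F]
    {Ω : Opens (Space d)} (μ : RadonMeasure Ω F) {x : Space d} (hx : x ∈ Ω) :
    ∃ r > 0, μ.variation (Metric.ball x r) < ∞ := by
  obtain ⟨r, hr, hsub⟩ := Metric.nhds_basis_closedBall.mem_iff.1 (Ω.isOpen.mem_nhds hx)
  exact ⟨r, hr, (measure_mono Metric.ball_subset_closedBall).trans_lt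
    (μ.variation_lt_top _ (isCompact_closedBall x r) hsub)⟩

/-- A Radon measure vanishing on every Lipschitz hypersurface of finite variation does not charge
Lipschitz hypersurfaces: the relatively open pieces of a hypersurface are hypersurfaces, so no
cancellation is possible. -/
theorem RadonMeasure.variation_eq_zero_of_vanishesOn {F : Type*} [NormedAddCommGroup F]
    [NormedSpace ℝ F] [CompleteSpace F] {Ω : Opens (Space d)} (μ : RadonMeasure Ω F)
    (h : ∀ S : Set (Space d), S ⊆ Ω → IsLipschitzHypersurface S → μ.VanishesOn S)
    {S : Set (Space d)} (hSΩ : S ⊆ Ω) (hS : IsLipschitzHypersurface S) : μ.variation S = 0 := by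
  refine measure_null_of_locally_null _ fun x hx => ?_
  obtain ⟨r, hr, hlt⟩ := μ.exists_ball_lt_top (hSΩ hx)
  refine ⟨S ∩ Metric.ball x r, inter_mem_nhdsWithin _ (Metric.ball_mem_nhds x hr), ?_⟩
  set B := Metric.ball x r
  set m := μ.variation.restrict (S ∩ B)
  have hlt' : μ.variation (S ∩ B) < ∞ := (measure_mono inter_subset_right).trans_lt hlt
  have : IsFiniteMeasure m := ⟨by simpa [m] using hlt'⟩
  have hnorm : ∀ᵐ y ∂m, ‖μ.direction y‖ = 1 := ae_restrict_of_ae μ.norm_direction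
  have hint : Integrable μ.direction m :=
    Integrable.of_bound μ.stronglyMeasurable_direction.aestronglyMeasurable 1
      (hnorm.mono fun y hy => hy.le)
  have hopen : ∀ V : Set (Space d), IsOpen V → ∫ y in V, μ.direction y ∂m = 0 := by
    intro V hV
    rw [Measure.restrict_restrict hV.measurableSet, inter_comm V, inter_assoc]
    exact h _ (inter_subset_left.trans hSΩ) (hS.inter_isOpen (Metric.isOpen_ball.inter hV))
      ((measure_mono (by rw [← inter_assoc]; exact inter_subset_left)).trans_lt hlt')
  have hzero := ae_eq_zero_of_forall_setIntegral_isClosed_eq_zero hint fun C hC => by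
    have h1 := integral_add_compl hC.measurableSet hint
    rw [hopen _ hC.isOpen_compl, add_zero] at h1
    rw [h1, ← setIntegral_univ, hopen _ isOpen_univ]
  have hF : ∀ᵐ y ∂m, False := by
    filter_upwards [hzero, hnorm] with y h1 h2
    simp [h1] at h2
  simpa [m] using hF

end Null

/-! ### Tangent directions of subsets of Lipschitz hypersurfaces -/

section Tangent

/-- At almost every point of an arbitrary set, every vector is tangent to the set: this is the
Lebesgue density theorem. -/
theorem ae_tangentConeAt_eq_univ {H : Type*} [NormedAddCommGroup H] [NormedSpace ℝ H]
    [FiniteDimensional ℝ H] [MeasurableSpace H] [BorelSpace H] (m : Measure H) [m.IsAddHaarMeasure]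
    (A : Set H) : ∀ᵐ q ∂m, q ∈ A → tangentConeAt ℝ A q = univ := by
  refine ae_imp_of_ae_restrict ?_
  filter_upwards [Besicovitch.ae_tendsto_measure_inter_div m A] with q hq
  refine eq_univ_of_forall fun v => ?_
  have hex : ∀ k : ℕ, ∃ r : ℝ, ∃ w : H, 0 < r ∧ r < 1 / ((k : ℝ) + 1) ∧
      ‖w - v‖ ≤ 1 / ((k : ℝ) + 1) ∧ q + r • w ∈ A := by
    intro k
    have hk : (0 : ℝ) < 1 / ((k : ℝ) + 1) := by positivity
    have h1 := Measure.eventually_nonempty_inter_smul_of_density_one m A q hq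
      (Metric.closedBall v (1 / ((k : ℝ) + 1))) Metric.isClosed_closedBall.measurableSet
      (Metric.measure_closedBall_pos m v hk).ne'
    obtain ⟨r, ⟨z, hzA, hz⟩, hr⟩ := (h1.and (Ioo_mem_nhdsGT hk)).exists
    rw [singleton_add, mem_image] at hz
    obtain ⟨y, ⟨w, hw, rfl⟩, rfl⟩ := hz
    exact ⟨r, w, hr.1, hr.2, by simpa [dist_eq_norm] using hw, hzA⟩
  choose r w hr0 hr1 hw hA using hex
  have hlim := tendsto_one_div_add_atTop_nhds_zero_nat (𝕜 := ℝ)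
  have hrlim : Tendsto r atTop (𝓝 0) :=
    squeeze_zero (fun k => (hr0 k).le) (fun k => (hr1 k).le) hlim
  have hwlim : Tendsto w atTop (𝓝 v) :=
    tendsto_iff_norm_sub_tendsto_zero.2 (squeeze_zero (fun k => norm_nonneg _) hw hlim)
  refine mem_tangentConeAt_of_seq atTop (fun k => (r k)⁻¹) (fun k => r k • w k) ?_
    (Eventually.of_forall hA) ?_
  · simpa using hrlim.smul hwlim
  · refine hwlim.congr fun k => ?_
    rw [smul_smul, inv_mul_cancel₀ (hr0 k).ne', one_smul]

variable {d : ℕ}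

/-- A Lipschitz hypersurface is locally the image of a Lipschitz map defined on a hyperplane and
inverted by the orthogonal projection. -/
theorem IsLipschitzHypersurface.exists_parametrization {S : Set (Space d)}
    (hS : IsLipschitzHypersurface S) {x : Space d} (hx : x ∈ S) :
    ∃ U : Set (Space d), IsOpen U ∧ x ∈ U ∧ ∃ ν : Space d, ‖ν‖ = 1 ∧
      ∃ Φ : (ℝ ∙ ν)ᗮ → Space d, (∃ K, LipschitzWith K Φ) ∧
        (∀ q, (ℝ ∙ ν)ᗮ.orthogonalProjectionOnto (Φ q) = q) ∧ (∀ q, Φ q ∈ U → Φ q ∈ S) ∧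
        S ∩ U ⊆ range Φ := by
  obtain ⟨U, hU, hxU, ν, hν, K, g, hg, h⟩ := hS x hx
  have hort : ∀ q : (ℝ ∙ ν)ᗮ, ⟪ν, (q : Space d)⟫ = 0 := fun q =>
    Submodule.mem_orthogonal_singleton_iff_inner_right.1 q.2
  have hν2 : ⟪ν, ν⟫ = 1 := by rw [real_inner_self_eq_norm_sq, hν]; norm_num
  refine ⟨U, hU, hxU, ν, hν, fun q => (q : Space d) + g q • ν, ?_, ?_, ?_, ?_⟩
  · refine ⟨_, (LipschitzWith.subtype_val _).add (?_ : LipschitzWith K _)⟩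
    refine LipschitzWith.of_dist_le_mul fun q q' => ?_
    rw [dist_eq_norm, ← sub_smul, norm_smul, hν, mul_one, ← dist_eq_norm]
    exact hg.dist_le_mul _ _
  · intro q
    have : (ℝ ∙ ν)ᗮ.orthogonalProjectionOnto ν = 0 := by
      rw [Submodule.orthogonalProjectionOnto_eq_zero_iff, Submodule.orthogonal_orthogonal]
      exact Submodule.mem_span_singleton_self ν
    simp [this]
  · intro q hq
    rw [h _ hq, inner_add_right, inner_smul_right, hort, hν2]
    simp
  · rintro y ⟨hyS, hyU⟩
    refine ⟨⟨y - ⟪ν, y⟫ • ν, ?_⟩, ?_⟩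
    · rw [Submodule.mem_orthogonal_singleton_iff_inner_right, inner_sub_right, inner_smul_right,
        hν2]
      simp
    · change y - ⟪ν, y⟫ • ν + g (y - ⟪ν, y⟫ • ν) • ν = y
      rw [← (h y hyU).1 hyS]
      simp

theorem finrank_hyperplane {ν : Space d} (hν : ‖ν‖ = 1) :
    Module.finrank ℝ (ℝ ∙ ν)ᗮ + 1 = d := by
  have h0 : ν ≠ 0 := by rintro rfl; simp at hν
  have := Submodule.finrank_add_finrank_orthogonal (ℝ ∙ ν)
  rw [finrank_span_singleton h0, finrank_euclideanSpace_fin] at this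
  omega

theorem IsLipschitzHypersurface.volume_eq_zero {S : Set (Space d)}
    (hS : IsLipschitzHypersurface S) : volume S = 0 := by
  refine measure_null_of_locally_null _ fun x hx => ?_
  obtain ⟨U, hU, hxU, ν, hν, Φ, ⟨K, hΦ⟩, -, -, hsub⟩ := hS.exists_parametrization hx
  refine ⟨S ∩ U, inter_mem_nhdsWithin _ (hU.mem_nhds hxU), measure_mono_null hsub ?_⟩
  have hac : (volume : Measure (Space d)) ≪ Measure.hausdorffMeasure ((d : ℝ≥0) : ℝ) := by
    have : (Measure.hausdorffMeasure ((d : ℝ≥0) : ℝ) : Measure (Space d)).IsAddHaarMeasure := by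
      have h := isAddHaarMeasure_hausdorffMeasure (E := Space d)
      rwa [finrank_euclideanSpace_fin] at h
    exact Measure.absolutelyContinuous_isAddHaarMeasure _ _
  refine measure_zero_of_dimH_lt hac ?_
  calc dimH (range Φ) ≤ dimH (univ : Set (ℝ ∙ ν)ᗮ) := by
        rw [← image_univ]; exact hΦ.dimH_image_le _
    _ = (Module.finrank ℝ (ℝ ∙ ν)ᗮ : ℝ≥0∞) := Real.dimH_univ_eq_finrank _
    _ < ((d : ℝ≥0) : ℝ≥0∞) := by
        have := finrank_hyperplane hν
        norm_cast
        omega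

/-- At almost every point `x` of an arbitrary subset `A` of a Lipschitz hypersurface, the
hyperplane orthogonal to a unit normal consists of tangent directions of `A`. The claim is
transported from the Lebesgue density theorem in a hyperplane by a Lipschitz parametrization, which
is almost everywhere differentiable by Rademacher's theorem. -/
theorem IsLipschitzHypersurface.ae_mem_tangentConeAt {S : Set (Space d)}
    (hS : IsLipschitzHypersurface S) {A : Set (Space d)} (hA : A ⊆ S) :
    ∀ᵐ x ∂surfaceMeasure d, x ∈ A → ∀ n : Space d, ‖n‖ = 1 →
      ((fun y => ⟪y - x, n⟫) =o[𝓝[S] x] fun y => y - x) →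
        ∀ v : Space d, ⟪v, n⟫ = 0 → v ∈ tangentConeAt ℝ A x := by
  set good : Set (Space d) := {x | ∀ n : Space d, ‖n‖ = 1 →
      ((fun y => ⟪y - x, n⟫) =o[𝓝[S] x] fun y => y - x) →
        ∀ v : Space d, ⟪v, n⟫ = 0 → v ∈ tangentConeAt ℝ A x} with hgood
  suffices h : surfaceMeasure d (A \ good) = 0 by
    filter_upwards [measure_eq_zero_iff_ae_notMem.1 h] with x hx hxA
    by_contra hxg
    exact hx ⟨hxA, hxg⟩
  refine measure_null_of_locally_null _ fun x hx => ?_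
  obtain ⟨U, hU, hxU, ν, hν, Φ, ⟨K, hΦ⟩, hproj, hΦS, hsub⟩ := hS.exists_parametrization (hA hx.1)
  refine ⟨(A \ good) ∩ U, inter_mem_nhdsWithin _ (hU.mem_nhds hxU), ?_⟩
  set m : Measure (ℝ ∙ ν)ᗮ := Measure.hausdorffMeasure (Module.finrank ℝ (ℝ ∙ ν)ᗮ)
  have hfin : ((d : ℝ) - 1) = Module.finrank ℝ (ℝ ∙ ν)ᗮ := by
    have h1 : (Module.finrank ℝ (ℝ ∙ ν)ᗮ : ℝ) + 1 = d := by exact_mod_cast finrank_hyperplane hν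
    linarith
  -- it suffices to look at the parameter domain, as Lipschitz maps preserve null sets
  suffices hm : m (Φ ⁻¹' ((A \ good) ∩ U)) = 0 by
    have himg := hΦ.hausdorffMeasure_image_le (d := Module.finrank ℝ (ℝ ∙ ν)ᗮ) (by positivity)
      (Φ ⁻¹' ((A \ good) ∩ U))
    rw [show Measure.hausdorffMeasure _ (Φ ⁻¹' ((A \ good) ∩ U)) = 0 from hm, mul_zero,
      image_preimage_eq_of_subset (fun y hy => hsub ⟨hA hy.1.1, hy.2⟩), ← hfin] at himg
    exact le_antisymm himg bot_le
  rw [measure_eq_zero_iff_ae_notMem]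
  filter_upwards [hΦ.ae_differentiableAt (μ := m), ae_tangentConeAt_eq_univ m (Φ ⁻¹' A)]
    with q hdiff htan hq
  refine hq.1.2 fun n hn ho v hv => ?_
  have hD := hdiff.hasFDerivAt
  set D := fderiv ℝ Φ q
  have hcone : ∀ w, D w ∈ tangentConeAt ℝ A (Φ q) := fun w =>
    tangentConeAt_mono (image_preimage_subset Φ A)
      (hD.hasFDerivWithinAt.mapsTo_tangent_cone ((htan hq.1.1).symm ▸ mem_univ w))
  -- the derivative of the parametrization is orthogonal to the normal
  have hDn : ∀ w, ⟪D w, n⟫ = 0 := by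
    have h1 : HasFDerivAt (fun q' => ⟪n, Φ q' - Φ q⟫) ((innerSL ℝ n).comp D) q :=
      ((innerSL ℝ n).hasFDerivAt.comp q (hD.sub_const (Φ q)))
    have h2 : HasFDerivAt (fun q' => ⟪n, Φ q' - Φ q⟫) (0 : (ℝ ∙ ν)ᗮ →L[ℝ] ℝ) q := by
      rw [hasFDerivAt_iff_isLittleO]
      have htend : Tendsto Φ (𝓝 q) (𝓝[S] (Φ q)) :=
        tendsto_nhdsWithin_iff.2 ⟨hΦ.continuous.continuousAt,
          (hΦ.continuous.continuousAt.eventually (hU.mem_nhds hq.2)).mono fun q' => hΦS q'⟩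
      have h3 := (ho.comp_tendsto htend).trans_isBigO
        hD.isBigO_sub
      refine h3.congr_left fun q' => ?_
      simp [real_inner_comm]
    intro w
    have := congrArg (fun L => L w) (h1.unique h2)
    simpa [real_inner_comm] using this
  have hinj : Function.Injective D := by
    have h1 : HasFDerivAt (fun q' => (ℝ ∙ ν)ᗮ.orthogonalProjectionOnto (Φ q'))
        ((ℝ ∙ ν)ᗮ.orthogonalProjectionOnto.comp D) q :=
      (ℝ ∙ ν)ᗮ.orthogonalProjectionOnto.hasFDerivAt.comp q hD
    have h2 : (ℝ ∙ ν)ᗮ.orthogonalProjectionOnto.comp D = ContinuousLinearMap.id ℝ _ :=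
      h1.unique (by simp_rw [hproj]; exact hasFDerivAt_id q)
    intro a b hab
    have := congrArg (fun L => L (a - b)) h2
    simpa [hab, sub_eq_zero, eq_comm] using this
  have hrange : LinearMap.range (D : (ℝ ∙ ν)ᗮ →ₗ[ℝ] Space d) = (ℝ ∙ n)ᗮ := by
    refine Submodule.eq_of_le_of_finrank_eq ?_ ?_
    · rintro _ ⟨w, rfl⟩
      exact Submodule.mem_orthogonal_singleton_iff_inner_left.2 (hDn w)
    · rw [LinearMap.finrank_range_of_inj hinj]
      have h1 := finrank_hyperplane hν
      have h2 := finrank_hyperplane hn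
      omega
  have hv' : v ∈ (ℝ ∙ n)ᗮ := Submodule.mem_orthogonal_singleton_iff_inner_left.2 hv
  rw [← hrange] at hv'
  obtain ⟨w, rfl⟩ := hv'
  exact hcone w

end Tangent

/-! ### Blow-ups and the direction of jumps -/

section BlowUp

variable {d : ℕ} {F : Type*}

theorem jumpProfile_smul (a b : F) (n : Space d) {t : ℝ} (ht : 0 < t) (z : Space d) :
    jumpProfile a b n (t • z) = jumpProfile a b n z := by
  unfold jumpProfile
  simp only [real_inner_smul_left, mul_nonneg_iff_of_pos_left ht]

theorem jumpProfile_self (a : F) (n : Space d) : jumpProfile a a n = fun _ => a := by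
  funext z; simp [jumpProfile]

theorem volume_hyperplane {n : Space d} (hn : ‖n‖ = 1) :
    volume {z : Space d | ⟪z, n⟫ = 0} = 0 := by
  have h : {z : Space d | ⟪z, n⟫ = 0} = ((ℝ ∙ n)ᗮ : Submodule ℝ (Space d)) := by
    ext z; exact Submodule.mem_orthogonal_singleton_iff_inner_left.symm
  rw [h]
  refine Measure.addHaar_submodule _ _ fun htop => ?_
  have := finrank_hyperplane hn
  rw [htop, finrank_top, finrank_euclideanSpace_fin] at this
  omega

theorem jumpProfile_neg_ae (a b : F) {n : Space d} (hn : ‖n‖ = 1) :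
    jumpProfile a b (-n) =ᵐ[volume] jumpProfile b a n := by
  filter_upwards [measure_eq_zero_iff_ae_notMem.1 (volume_hyperplane hn)] with z hz
  have hz : ⟪z, n⟫ ≠ 0 := hz
  unfold jumpProfile
  rw [inner_neg_right]
  rcases lt_or_gt_of_ne hz with h | h
  · rw [if_pos (by linarith), if_neg (by linarith)]
  · rw [if_neg (by linarith), if_pos h.le]

variable [NormedAddCommGroup F]

theorem IsBlowUp.congr_ae {g : Space d → F} {x : Space d} {v w : Space d → F}
    (h : IsBlowUp g x v) (hvw : v =ᵐ[volume] w) : IsBlowUp g x w := by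
  refine Tendsto.congr (fun ℓ => lintegral_congr_ae (ae_restrict_of_ae ?_)) h
  filter_upwards [hvw] with z hz
  rw [hz]

/-- The change of variables `y = x + ℓ z`; no measurability of the integrand is needed. -/
theorem setLIntegral_ball_comp_affine (G : Space d → ℝ≥0∞) (x : Space d) {ℓ : ℝ} (hℓ : 0 < ℓ) :
    ∫⁻ z in Metric.ball (0 : Space d) 1, G (x + ℓ • z) =
      (ENNReal.ofReal (ℓ ^ d))⁻¹ * ∫⁻ y in Metric.ball x ℓ, G y := by
  let e : Space d ≃ᵐ Space d :=
    ((Homeomorph.smulOfNeZero ℓ hℓ.ne').trans (Homeomorph.addLeft x)).toMeasurableEquiv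
  have he : ∀ z, e z = x + ℓ • z := fun z => rfl
  have hmap : Measure.map e volume = (ENNReal.ofReal (ℓ ^ d))⁻¹ • (volume : Measure (Space d)) := by
    have h1 : Measure.map e volume =
        Measure.map (fun z => x + z) (Measure.map (fun z : Space d => ℓ • z) volume) := by
      rw [Measure.map_map (measurable_const_add x) (measurable_const_smul ℓ)]; rfl
    rw [h1, Measure.map_addHaar_smul _ hℓ.ne', Measure.map_smul, map_add_left_eq_self,
      finrank_euclideanSpace_fin, abs_of_pos (by positivity),
      ENNReal.ofReal_inv_of_pos (by positivity)]
  have hpre : Metric.ball (0 : Space d) 1 = e ⁻¹' Metric.ball x ℓ := by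
    ext z
    simp [he, norm_smul, abs_of_pos hℓ, mul_lt_iff_lt_one_right hℓ]
  calc _ = ∫⁻ z in e ⁻¹' Metric.ball x ℓ, G (e z) := by rw [hpre]; rfl
    _ = ∫⁻ y in Metric.ball x ℓ, G y ∂(Measure.map e volume) := by
      rw [← lintegral_map_equiv, MeasurableEquiv.restrict_map]
    _ = _ := by rw [hmap, Measure.restrict_smul, lintegral_smul_measure, smul_eq_mul]

theorem setLIntegral_blowUp_jumpProfile (g : Space d → F) (x : Space d) (a b : F) (n : Space d)
    {ℓ : ℝ} (hℓ : 0 < ℓ) :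
    ∫⁻ z in Metric.ball (0 : Space d) 1, ‖g (x + ℓ • z) - jumpProfile a b n z‖ₑ =
      (ENNReal.ofReal (ℓ ^ d))⁻¹ *
        ∫⁻ y in Metric.ball x ℓ, ‖g y - jumpProfile a b n (y - x)‖ₑ := by
  rw [← setLIntegral_ball_comp_affine (fun y => ‖g y - jumpProfile a b n (y - x)‖ₑ) x hℓ]
  simp only [add_sub_cancel_left, jumpProfile_smul a b n hℓ]

end BlowUp

section Alignment

variable {d : ℕ} {Ω : Opens (Space d)} {S : Set (Space d)} {g : Space d → ℝ}

/-- If on a ball `g` is close in mean both to `a` and to `b`, then `a` is close to `b`. -/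
theorem enorm_sub_mul_volume_ball_le {x y z : Space d} {R R' s : ℝ} {P Q : Space d → ℝ} {a b : ℝ}
    {ε ε' : ℝ≥0∞} (hg : AEStronglyMeasurable g (volume.restrict (Metric.ball z s)))
    (hx : ∫⁻ w in Metric.ball x R, ‖g w - P (w - x)‖ₑ ≤ ε)
    (hy : ∫⁻ w in Metric.ball y R', ‖g w - Q (w - y)‖ₑ ≤ ε')
    (hzx : Metric.ball z s ⊆ Metric.ball x R) (hzy : Metric.ball z s ⊆ Metric.ball y R')
    (hP : ∀ w ∈ Metric.ball z s, P (w - x) = a) (hQ : ∀ w ∈ Metric.ball z s, Q (w - y) = b) :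
    ‖a - b‖ₑ * volume (Metric.ball z s) ≤ ε + ε' := by
  calc ‖a - b‖ₑ * volume (Metric.ball z s) = ∫⁻ _ in Metric.ball z s, ‖a - b‖ₑ := by simp
    _ ≤ ∫⁻ w in Metric.ball z s, (‖g w - a‖ₑ + ‖g w - b‖ₑ) := by
        refine lintegral_mono fun w => ?_
        rw [show a - b = (g w - b) - (g w - a) by ring, add_comm]
        exact enorm_sub_le
    _ = (∫⁻ w in Metric.ball z s, ‖g w - a‖ₑ) + ∫⁻ w in Metric.ball z s, ‖g w - b‖ₑ :=
        lintegral_add_left' (hg.sub aestronglyMeasurable_const).enorm _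
    _ ≤ ε + ε' := by
        gcongr
        · refine le_trans (le_of_eq ?_) ((lintegral_mono_set hzx).trans hx)
          exact setLIntegral_congr_fun Metric.isOpen_ball.measurableSet
            fun w hw => by simp only [hP w hw]
        · refine le_trans (le_of_eq ?_) ((lintegral_mono_set hzy).trans hy)
          exact setLIntegral_congr_fun Metric.isOpen_ball.measurableSet
            fun w hw => by simp only [hQ w hw]

/-- Two nearby points with similar jump profiles are aligned almost orthogonally to the direction of
the jump: otherwise a ball of comparable size would lie on the `a`-side of one of them and on the
`b`-side of the other. -/
theorem abs_inner_le_of_similar_jumps {x y m m' : Space d} {a b a' b' c κ : ℝ} {δ : ℝ≥0∞}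
    (hg : AEStronglyMeasurable g (volume.restrict Ω)) (hm : ‖m‖ = 1) (hm' : ‖m'‖ = 1)
    (hmm : ‖m - m'‖ ≤ 1 / 2) (hc : 0 < c) (hc1 : c ≤ 1) (hκ : 0 < κ) (hab : κ ≤ |a - b'|)
    (hba : κ ≤ |b - a'|) (hxy : x ≠ y) (hΩ : Metric.ball x (3 * ‖y - x‖) ⊆ Ω)
    (hδ : δ = ENNReal.ofReal κ * ENNReal.ofReal ((c / 24) ^ d) *
      volume (Metric.ball (0 : Space d) 1) / 4)
    (hx : ∫⁻ w in Metric.ball x (3 * ‖y - x‖), ‖g w - jumpProfile a b m (w - x)‖ₑ ≤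
      δ * ENNReal.ofReal ((3 * ‖y - x‖) ^ d))
    (hy : ∫⁻ w in Metric.ball y (3 * ‖y - x‖), ‖g w - jumpProfile a' b' m' (w - y)‖ₑ ≤
      δ * ENNReal.ofReal ((3 * ‖y - x‖) ^ d)) :
    |⟪y - x, m⟫| ≤ c * ‖y - x‖ := by
  set r := ‖y - x‖ with hr
  have hr0 : 0 < r := norm_pos_iff.2 (sub_ne_zero.2 hxy.symm)
  have hinner : 1 / 2 ≤ ⟪m, m'⟫ := by
    have h1 : ⟪m, m'⟫ = ⟪m, m⟫ - ⟪m, m - m'⟫ := by rw [inner_sub_right]; ring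
    have h2 := real_inner_le_norm m (m - m')
    rw [real_inner_self_eq_norm_sq] at h1
    rw [hm] at h1 h2
    linarith
  -- the ball of radius `c r / 8` around `y - t m`, for `t = ± c r / 2`, separates the two profiles
  have hcontra : ∀ (z : Space d) (α β : ℝ), κ ≤ |α - β| → ‖z - y‖ ≤ c * r / 2 →
      (∀ w ∈ Metric.ball z (c * r / 8), jumpProfile a b m (w - x) = α) →
      (∀ w ∈ Metric.ball z (c * r / 8), jumpProfile a' b' m' (w - y) = β) → False := by
    intro z α β hαβ hz hα hβ
    have hcr : c * r ≤ r := by nlinarith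
    have hzy : Metric.ball z (c * r / 8) ⊆ Metric.ball y (3 * r) := by
      refine Metric.ball_subset_ball' ?_
      rw [dist_eq_norm]; linarith
    have hzx : Metric.ball z (c * r / 8) ⊆ Metric.ball x (3 * r) := by
      refine Metric.ball_subset_ball' ?_
      have := dist_triangle z y x
      rw [dist_eq_norm z y, dist_eq_norm y x] at this
      linarith
    have h := enorm_sub_mul_volume_ball_le
      (hg.mono_measure (Measure.restrict_mono (hzx.trans hΩ) le_rfl)) hx hy hzx hzy hα hβ
    set ω := volume (Metric.ball (0 : Space d) 1)
    have hω : ω ≠ ∞ := measure_ball_lt_top.ne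
    have hω0 : ω ≠ 0 := (Metric.measure_ball_pos _ _ one_pos).ne'
    rw [Measure.addHaar_ball_of_pos _ _ (by positivity), finrank_euclideanSpace_fin] at h
    set Q := ENNReal.ofReal κ * ENNReal.ofReal ((c * r / 8) ^ d) * ω with hQ
    have hQ0 : Q ≠ 0 := by
      simp only [hQ, ne_eq, mul_eq_zero, ENNReal.ofReal_eq_zero, not_or, not_le]
      exact ⟨⟨hκ, by positivity⟩, hω0⟩
    have hQt : Q ≠ ∞ := by finiteness
    have h1 : Q ≤ ‖α - β‖ₑ * (ENNReal.ofReal ((c * r / 8) ^ d) * ω) := by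
      rw [hQ, mul_assoc, ← ofReal_norm, Real.norm_eq_abs]
      gcongr
    have h2 : δ * ENNReal.ofReal ((3 * r) ^ d) = Q / 4 := by
      have h3 : ENNReal.ofReal ((c * r / 8) ^ d) =
          ENNReal.ofReal ((c / 24) ^ d) * ENNReal.ofReal ((3 * r) ^ d) := by
        rw [← ENNReal.ofReal_mul (by positivity), ← mul_pow]
        congr 2; ring
      rw [hδ, hQ, h3]
      generalize ENNReal.ofReal ((c / 24) ^ d) = A
      generalize ENNReal.ofReal ((3 * r) ^ d) = B
      simp only [div_eq_mul_inv]
      ring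
    rw [h2] at h
    have h3 : Q / 4 + Q / 4 = Q / 2 := by
      rw [← ENNReal.add_div, ← two_mul, show (4 : ℝ≥0∞) = 2 * 2 by norm_num,
        ENNReal.mul_div_mul_left _ _ (by simp) (by simp)]
    rw [h3] at h
    exact absurd (h1.trans h) (not_le.2 (ENNReal.half_lt_self hQ0 hQt))
  have hw : ∀ z w e : Space d, ‖e‖ = 1 → w ∈ Metric.ball z (c * r / 8) →
      |⟪w - z, e⟫| < c * r / 8 := by
    intro z w e he hw
    rw [mem_ball_iff_norm] at hw
    have := abs_real_inner_le_norm (w - z) e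
    rw [he, mul_one] at this
    linarith
  have hcr : 0 < c * r := by positivity
  have hcr' : c * r / 2 * (1 / 2) ≤ c * r / 2 * ⟪m, m'⟫ := by gcongr
  have hmm1 : ⟪m, m⟫ = 1 := by rw [real_inner_self_eq_norm_sq, hm]; norm_num
  by_contra hlt
  rw [not_le, lt_abs] at hlt
  rcases hlt with hlt | hlt
  · refine hcontra (y - (c * r / 2) • m) a b' hab ?_ (fun w h => ?_) (fun w h => ?_)
    · rw [sub_sub_cancel_left, norm_neg, norm_smul, hm, mul_one, Real.norm_of_nonneg (by positivity)]
    · have h1 := (abs_lt.1 (hw _ w m hm h)).1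
      have h2 : ⟪w - x, m⟫ = ⟪w - (y - (c * r / 2) • m), m⟫ + ⟪y - x, m⟫ - c * r / 2 * ⟪m, m⟫ := by
        simp only [inner_sub_left, real_inner_smul_left]; ring
      rw [hmm1] at h2
      exact if_pos (by linarith)
    · have h1 := (abs_lt.1 (hw _ w m' hm' h)).2
      have h2 : ⟪w - y, m'⟫ = ⟪w - (y - (c * r / 2) • m), m'⟫ - c * r / 2 * ⟪m, m'⟫ := by
        simp only [inner_sub_left, real_inner_smul_left]; ring
      exact if_neg (by linarith)
  · refine hcontra (y + (c * r / 2) • m) b a' hba ?_ (fun w h => ?_) (fun w h => ?_)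
    · rw [add_sub_cancel_left, norm_smul, hm, mul_one, Real.norm_of_nonneg (by positivity)]
    · have h1 := (abs_lt.1 (hw _ w m hm h)).2
      have h2 : ⟪w - x, m⟫ = ⟪w - (y + (c * r / 2) • m), m⟫ + ⟪y - x, m⟫ + c * r / 2 * ⟪m, m⟫ := by
        simp only [inner_sub_left, inner_add_left, real_inner_smul_left]; ring
      rw [hmm1] at h2
      exact if_neg (by linarith)
    · have h1 := (abs_lt.1 (hw _ w m' hm' h)).1
      have h2 : ⟪w - y, m'⟫ = ⟪w - (y + (c * r / 2) • m), m'⟫ + c * r / 2 * ⟪m, m'⟫ := by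
        simp only [inner_sub_left, inner_add_left, real_inner_smul_left]; ring
      exact if_pos (by linarith)

theorem abs_inner_le_of_mem_tangentConeAt {A : Set (Space d)} {x m v : Space d} {c ρ : ℝ}
    (hρ : 0 < ρ) (h : ∀ y ∈ A, ‖y - x‖ < ρ → |⟪y - x, m⟫| ≤ c * ‖y - x‖)
    (hv : v ∈ tangentConeAt ℝ A x) : |⟪v, m⟫| ≤ c * ‖v‖ := by
  obtain ⟨ι, l, hl, s, e, he, hA, hlim⟩ := exists_fun_of_mem_tangentConeAt hv
  have h1 : Tendsto (fun i => |⟪s i • e i, m⟫|) l (𝓝 |⟪v, m⟫|) :=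
    (hlim.inner tendsto_const_nhds).abs
  have h2 : Tendsto (fun i => c * ‖s i • e i‖) l (𝓝 (c * ‖v‖)) := hlim.norm.const_mul c
  refine le_of_tendsto_of_tendsto h1 h2 ?_
  filter_upwards [hA, he.norm.eventually_lt_const (by simpa using hρ)] with i hi hi'
  have h3 := h _ hi (by simpa using hi')
  rw [add_sub_cancel_left] at h3
  rw [real_inner_smul_left, abs_mul, norm_smul, Real.norm_eq_abs, mul_left_comm]
  gcongr

/-- At almost every jump point of `g` on a Lipschitz hypersurface, the direction of the jump is
normal to the hypersurface. -/
theorem ae_jump_direction (hg : AEStronglyMeasurable g (volume.restrict Ω)) (hSΩ : S ⊆ Ω)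
    (hS : IsLipschitzHypersurface S) :
    ∀ᵐ x ∂surfaceMeasure d, x ∈ S → ∀ n : Space d, ‖n‖ = 1 →
      ((fun y => ⟪y - x, n⟫) =o[𝓝[S] x] fun y => y - x) → IsJumpPoint g x →
        ∃ (a b : ℝ) (m : Space d), (m = n ∨ m = -n) ∧ IsBlowUp g x (jumpProfile a b m) := by
  have hch : ∀ x : Space d, ∃ q : ℝ × ℝ × Space d, IsJumpPoint g x →
      ‖q.2.2‖ = 1 ∧ q.1 ≠ q.2.1 ∧ IsBlowUp g x (jumpProfile q.1 q.2.1 q.2.2) := by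
    intro x
    by_cases h : IsJumpPoint g x
    · obtain ⟨a, b, m, h⟩ := h
      exact ⟨(a, b, m), fun _ => h⟩
    · exact ⟨0, fun h' => absurd h' h⟩
  choose q hq using hch
  set κ : ℕ → ℝ := fun k => 1 / ((k : ℝ) + 1)
  have hκ0 : ∀ k, 0 < κ k := fun k => by positivity
  have hκ1 : ∀ k, κ k ≤ 1 := fun k => by
    simp only [κ]; rw [div_le_one (by positivity)]; linarith [(k.cast_nonneg : (0 : ℝ) ≤ k)]
  set δ : ℕ → ℕ → ℝ≥0∞ := fun j k => ENNReal.ofReal (κ k) * ENNReal.ofReal ((κ j / 24) ^ d) *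
      volume (Metric.ball (0 : Space d) 1) / 4
  -- uniform pieces of the jump set: the jump profile is known up to a small error, and so are the
  -- scales at which it is seen
  set A : ℕ → ℕ → ℕ → ℕ → Set (Space d) := fun j k N i => {x | x ∈ S ∧ IsJumpPoint g x ∧
    2 * κ k ≤ |(q x).1 - (q x).2.1| ∧ dist (q x) (denseSeq (ℝ × ℝ × Space d) i) < κ k / 4 ∧
    Metric.ball x (κ N) ⊆ Ω ∧ ∀ ℓ, 0 < ℓ → ℓ < κ N →
      ∫⁻ w in Metric.ball x ℓ, ‖g w - jumpProfile (q x).1 (q x).2.1 (q x).2.2 (w - x)‖ₑ ≤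
        δ j k * ENNReal.ofReal (ℓ ^ d)}
  have hκlim : Tendsto κ atTop (𝓝 0) := tendsto_one_div_add_atTop_nhds_zero_nat
  have hcover : ∀ x ∈ S, IsJumpPoint g x → ∀ j, ∃ k N i, x ∈ A j k N i := by
    intro x hxS hx j
    obtain ⟨-, hne, hbl⟩ := hq x hx
    obtain ⟨k, hk⟩ := (hκlim.eventually_lt_const
      (show (0 : ℝ) < |(q x).1 - (q x).2.1| / 2 by
        have := abs_pos.2 (sub_ne_zero.2 hne); linarith)).exists
    obtain ⟨i, hi⟩ := Metric.denseRange_iff.1 (denseRange_denseSeq (ℝ × ℝ × Space d)) (q x)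
      (κ k / 4) (by linarith [hκ0 k])
    have hδ0 : 0 < δ j k := by
      refine ENNReal.div_pos ?_ (by simp)
      simp only [ne_eq, mul_eq_zero, ENNReal.ofReal_eq_zero, not_or, not_le]
      exact ⟨⟨hκ0 k, pow_pos (by linarith [hκ0 j]) _⟩, (Metric.measure_ball_pos _ _ one_pos).ne'⟩
    obtain ⟨ε, hε, hball⟩ := Metric.isOpen_iff.1 Ω.isOpen x (hSΩ hxS)
    have hev := (ENNReal.tendsto_nhds_zero.1 hbl) _ hδ0
    obtain ⟨ε', hε', hsub⟩ := mem_nhdsGT_iff_exists_Ioo_subset.1 hev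
    obtain ⟨N, hN⟩ := (hκlim.eventually_lt_const (lt_min hε hε')).exists
    refine ⟨k, N, i, hxS, hx, by linarith, hi,
      (Metric.ball_subset_ball (hN.le.trans (min_le_left _ _))).trans hball, fun ℓ h0 hℓ => ?_⟩
    have h1 := hsub ⟨h0, hℓ.trans (hN.trans_le (min_le_right _ _))⟩
    rw [mem_ofPred_eq, setLIntegral_blowUp_jumpProfile _ _ _ _ _ h0] at h1
    have h2 : ENNReal.ofReal (ℓ ^ d) ≠ 0 := by
      simp only [ne_eq, ENNReal.ofReal_eq_zero, not_le]; positivity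
    rwa [mul_comm, ← div_eq_mul_inv, ENNReal.div_le_iff h2 ENNReal.ofReal_ne_top] at h1
  have hae : ∀ᵐ x ∂surfaceMeasure d, ∀ j k N i, x ∈ A j k N i → ∀ n : Space d, ‖n‖ = 1 →
      ((fun y => ⟪y - x, n⟫) =o[𝓝[S] x] fun y => y - x) →
        ∀ v : Space d, ⟪v, n⟫ = 0 → v ∈ tangentConeAt ℝ (A j k N i) x := by
    simp only [ae_all_iff]
    exact fun j k N i => hS.ae_mem_tangentConeAt fun x hx => hx.1
  filter_upwards [hae] with x hx hxS n hn ho hjump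
  refine ⟨_, _, _, ?_, (hq x hjump).2.2⟩
  have hm := (hq x hjump).1
  set m := (q x).2.2
  have hcone : ∀ j, ∀ v : Space d, ⟪v, n⟫ = 0 → |⟪v, m⟫| ≤ κ j * ‖v‖ := by
    intro j v hv
    obtain ⟨k, N, i, hA⟩ := hcover x hxS hjump j
    refine abs_inner_le_of_mem_tangentConeAt (ρ := κ N / 3) (by linarith [hκ0 N]) ?_
      (hx j k N i hA n hn ho v hv)
    intro y hy hyx
    rcases eq_or_ne x y with rfl | hne
    · simp
    have hd : dist (q x) (q y) < κ k / 2 := by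
      have := dist_triangle_right (q x) (q y) (denseSeq (ℝ × ℝ × Space d) i)
      linarith [hA.2.2.2.1, hy.2.2.2.1]
    have hd1 : |(q x).1 - (q y).1| < κ k / 2 := (le_max_left _ _).trans_lt hd
    have hd2 : |(q x).2.1 - (q y).2.1| < κ k / 2 :=
      ((le_max_left _ _).trans (le_max_right _ _)).trans_lt hd
    have hd3 : ‖(q x).2.2 - (q y).2.2‖ < κ k / 2 := by
      rw [← dist_eq_norm]
      exact ((le_max_right _ _).trans (le_max_right _ _)).trans_lt hd
    have hpos : 0 < ‖y - x‖ := norm_pos_iff.2 (sub_ne_zero.2 hne.symm)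
    have hjx := hA.2.2.1
    have hjy := hy.2.2.1
    refine abs_inner_le_of_similar_jumps (a := (q x).1) (b := (q x).2.1) (a' := (q y).1)
      (b' := (q y).2.1) (m' := (q y).2.2) (κ := κ k) hg hm (hq y hy.2.1).1
      (by linarith [hκ1 k]) (hκ0 j) (hκ1 j) (hκ0 k) ?_ ?_ hne
      ((Metric.ball_subset_ball (by linarith)).trans hA.2.2.2.2.1) rfl
      (hA.2.2.2.2.2 _ (by positivity) (by linarith)) (hy.2.2.2.2.2 _ (by positivity) (by linarith))
    · have := abs_sub_le (q x).1 (q y).2.1 (q x).2.1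
      rw [abs_sub_comm (q y).2.1] at this
      linarith [hκ0 k]
    · rw [abs_sub_comm (q x).1 (q x).2.1] at hjx
      have := abs_sub_le (q x).2.1 (q y).1 (q x).1
      rw [abs_sub_comm (q y).1] at this
      linarith [hκ0 k]
  -- the opening of the cone is arbitrary, so the direction of the jump is normal
  have hzero : ∀ v : Space d, ⟪v, n⟫ = 0 → ⟪v, m⟫ = 0 := fun v hv => by
    have h1 := ge_of_tendsto' (hκlim.mul_const ‖v‖) fun j => hcone j v hv
    rw [zero_mul] at h1
    exact abs_eq_zero.1 (le_antisymm h1 (abs_nonneg _))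
  have h1 := hzero (m - ⟪m, n⟫ • n) (by
    rw [inner_sub_left, real_inner_smul_left, real_inner_self_eq_norm_sq, hn]; ring)
  rw [inner_sub_left, real_inner_smul_left, real_inner_self_eq_norm_sq, hm,
    real_inner_comm m n] at h1
  have h2 : (⟪m, n⟫ - 1) * (⟪m, n⟫ + 1) = 0 := by
    have h3 : ⟪n, m⟫ = ⟪m, n⟫ := real_inner_comm _ _
    nlinarith
  rcases mul_eq_zero.1 h2 with h | h
  · exact Or.inl ((inner_eq_one_iff_of_norm_eq_one (𝕜 := ℝ) hm hn).1 (by linarith))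
  · refine Or.inr ((inner_eq_one_iff_of_norm_eq_one (𝕜 := ℝ) hm (by rwa [norm_neg])).1 ?_)
    rw [inner_neg_right]; linarith

/-- If `g` has bilateral traces at a Lipschitz hypersurface, then at almost all of its points `g`
has one-sided limits along the unit normal. -/
theorem ae_exists_oneSidedLimits (hg : AEStronglyMeasurable g (volume.restrict Ω)) (hSΩ : S ⊆ Ω)
    (hS : IsLipschitzHypersurface S) :
    ∀ᵐ x ∂surfaceMeasure d, x ∈ S → ∀ n : Space d, ‖n‖ = 1 →
      ((fun y => ⟪y - x, n⟫) =o[𝓝[S] x] fun y => y - x) → (IsLebesguePoint g x ∨ IsJumpPoint g x) →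
        ∃ a b : ℝ, HasOneSidedLimits g x n a b := by
  filter_upwards [ae_jump_direction hg hSΩ hS] with x hx hxS n hn ho hcase
  rcases hcase with ⟨c, hc⟩ | hj
  · exact ⟨c, c, by rwa [HasOneSidedLimits, jumpProfile_self]⟩
  · obtain ⟨a, b, m, rfl | rfl, h⟩ := hx hxS n hn ho hj
    · exact ⟨a, b, h⟩
    · exact ⟨b, a, h.congr_ae (jumpProfile_neg_ae a b hn)⟩

end Alignment

/-! ### Calculus of one-sided limits, and a radial test function -/

section BlowUpCalculus

variable {d : ℕ} {Ω : Opens (Space d)}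

theorem stronglyMeasurable_jumpProfile {F : Type*} [TopologicalSpace F] (a b : F) (n : Space d) :
    StronglyMeasurable (jumpProfile a b n) :=
  StronglyMeasurable.ite (measurableSet_le measurable_const (by fun_prop))
    stronglyMeasurable_const stronglyMeasurable_const

theorem eventually_ball_subset {x : Space d} (hx : x ∈ Ω) :
    ∀ᶠ ℓ in 𝓝[>] (0 : ℝ), 0 < ℓ ∧ Metric.ball x ℓ ⊆ Ω := by
  obtain ⟨ε, hε, hb⟩ := Metric.isOpen_iff.1 Ω.isOpen x hx
  filter_upwards [Ioo_mem_nhdsGT hε] with ℓ hℓ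
  exact ⟨hℓ.1, (Metric.ball_subset_ball hℓ.2.le).trans hb⟩

/-- The components of a vector field may be blown up separately. -/
theorem HasOneSidedLimits.of_components {v : Space d → Space d}
    (hv : AEStronglyMeasurable v (volume.restrict Ω)) {x n a b : Space d} (hx : x ∈ Ω)
    (h : ∀ i, HasOneSidedLimits (fun y => v y i) x n (a i) (b i)) :
    HasOneSidedLimits v x n a b := by
  have hsum : Tendsto (fun ℓ : ℝ => ∑ i, ∫⁻ z in Metric.ball (0 : Space d) 1,
      ‖v (x + ℓ • z) i - jumpProfile (a i) (b i) n z‖ₑ) (𝓝[>] 0) (𝓝 0) := by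
    simpa using tendsto_finsetSum Finset.univ fun i _ => h i
  refine tendsto_of_tendsto_of_tendsto_of_le_of_le' tendsto_const_nhds hsum
    (Eventually.of_forall fun _ => bot_le) ?_
  filter_upwards [eventually_ball_subset hx] with ℓ hℓ
  simp_rw [setLIntegral_blowUp_jumpProfile v x a b n hℓ.1,
    fun i => setLIntegral_blowUp_jumpProfile (fun y => v y i) x (a i) (b i) n hℓ.1]
  rw [← Finset.mul_sum, ← lintegral_finsetSum']
  · gcongr with y
    set w := v y - jumpProfile a b n (y - x) with hw
    have hi : ∀ i, v y i - jumpProfile (a i) (b i) n (y - x) = w i := fun i => by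
      rw [hw, PiLp.sub_apply]
      congr 1
      unfold jumpProfile
      split_ifs <;> rfl
    simp_rw [hi]
    have h1 : ‖w‖ ≤ ∑ i, ‖w i‖ := by
      have h2 : w = ∑ i, w i • EuclideanSpace.single i (1 : ℝ) := by
        ext j
        simp [Finset.sum_apply, Pi.single_apply]
      calc ‖w‖ = ‖∑ i, w i • EuclideanSpace.single i (1 : ℝ)‖ := by rw [← h2]
        _ ≤ ∑ i, ‖w i • EuclideanSpace.single i (1 : ℝ)‖ := norm_sum_le _ _
        _ = ∑ i, ‖w i‖ := by simp [norm_smul]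
    simp_rw [← ofReal_norm]
    rw [← ENNReal.ofReal_sum_of_nonneg fun i _ => norm_nonneg _]
    exact ENNReal.ofReal_le_ofReal h1
  · intro i _
    have h1 : AEStronglyMeasurable (fun y => v y i) (volume.restrict (Metric.ball x ℓ)) :=
      (EuclideanSpace.proj (𝕜 := ℝ) i).continuous.comp_aestronglyMeasurable
        (hv.mono_measure (Measure.restrict_mono hℓ.2 le_rfl))
    refine (h1.sub ?_).enorm
    exact ((stronglyMeasurable_jumpProfile _ _ _).comp_measurable
      (measurable_id.sub_const x)).aestronglyMeasurable

variable {F G : Type*} [NormedAddCommGroup F] [NormedAddCommGroup G]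

theorem HasOneSidedLimits.prodMk {g : Space d → F} {k : Space d → G}
    (hg : AEStronglyMeasurable g (volume.restrict Ω)) {x n : Space d} (hx : x ∈ Ω) {a b : F}
    {a' b' : G} (h : HasOneSidedLimits g x n a b) (h' : HasOneSidedLimits k x n a' b') :
    HasOneSidedLimits (fun y => (g y, k y)) x n (a, a') (b, b') := by
  have hsum := Tendsto.add h h'
  rw [add_zero] at hsum
  refine tendsto_of_tendsto_of_tendsto_of_le_of_le' tendsto_const_nhds hsum
    (Eventually.of_forall fun _ => bot_le) ?_
  filter_upwards [eventually_ball_subset hx] with ℓ hℓ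
  rw [setLIntegral_blowUp_jumpProfile (fun y => (g y, k y)) x _ _ n hℓ.1,
    setLIntegral_blowUp_jumpProfile g x a b n hℓ.1,
    setLIntegral_blowUp_jumpProfile k x a' b' n hℓ.1, ← mul_add, ← lintegral_add_left']
  · gcongr with y
    have h1 : jumpProfile (a, a') (b, b') n (y - x) =
        (jumpProfile a b n (y - x), jumpProfile a' b' n (y - x)) := by
      unfold jumpProfile
      split_ifs <;> rfl
    rw [h1, Prod.mk_sub_mk, ← ofReal_norm, ← ofReal_norm, ← ofReal_norm,
      ← ENNReal.ofReal_add (norm_nonneg _) (norm_nonneg _)]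
    exact ENNReal.ofReal_le_ofReal (max_le_add_of_nonneg (norm_nonneg _) (norm_nonneg _))
  · refine ((hg.mono_measure (Measure.restrict_mono hℓ.2 le_rfl)).sub ?_).enorm
    exact ((stronglyMeasurable_jumpProfile _ _ _).comp_measurable
      (measurable_id.sub_const x)).aestronglyMeasurable

/-- A continuous function on a proper space is, on bounded sets, Lipschitz up to a small error. -/
theorem exists_norm_sub_le_add_mul [ProperSpace F] {Φ : F → G} (hΦ : Continuous Φ) (M : ℝ)
    (a : F) {ε : ℝ} (hε : 0 < ε) :
    ∃ C : ℝ, 0 ≤ C ∧ ∀ w, ‖w‖ ≤ M → ‖Φ w - Φ a‖ ≤ ε + C * ‖w - a‖ := by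
  obtain ⟨η, hη, h⟩ := Metric.continuous_iff.1 hΦ a ε hε
  obtain ⟨B, hB⟩ := (isCompact_closedBall (0 : F) M).exists_bound_of_continuousOn
    (hΦ.sub (continuous_const (y := Φ a))).continuousOn
  refine ⟨|B| / η, by positivity, fun w hw => ?_⟩
  rcases lt_or_ge ‖w - a‖ η with hlt | hge
  · have h1 := h w (by rwa [dist_eq_norm])
    rw [dist_eq_norm] at h1
    have : 0 ≤ |B| / η * ‖w - a‖ := by positivity
    linarith
  · have h1 : ‖Φ w - Φ a‖ ≤ |B| := (hB w (by simpa using hw)).trans (le_abs_self B)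
    have h2 : |B| ≤ |B| / η * ‖w - a‖ := by
      rw [div_mul_eq_mul_div, le_div_iff₀ hη]
      gcongr
    linarith

/-- Blow-ups of bounded functions are stable under composition with continuous functions. -/
theorem HasOneSidedLimits.continuous_comp [ProperSpace F] {Φ : F → G} (hΦ : Continuous Φ)
    {g : Space d → F} {M : ℝ} (hM : ∀ᵐ y ∂volume.restrict (Ω : Set (Space d)), ‖g y‖ ≤ M)
    {x n : Space d} (hx : x ∈ Ω) {a b : F} (h : HasOneSidedLimits g x n a b) :
    HasOneSidedLimits (fun y => Φ (g y)) x n (Φ a) (Φ b) := by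
  refine ENNReal.tendsto_nhds_zero.2 fun η hη => ?_
  set ω := volume (Metric.ball (0 : Space d) 1)
  have hω : ω ≠ ∞ := measure_ball_lt_top.ne
  obtain ⟨ε, hε, hεω⟩ : ∃ ε : ℝ, 0 < ε ∧ ENNReal.ofReal ε * ω ≤ η / 2 := by
    obtain ⟨ε, hε, hlt⟩ := ENNReal.exists_nnreal_pos_mul_lt hω (ENNReal.half_pos hη.ne').ne'
    exact ⟨ε, hε, by simpa using hlt.le⟩
  obtain ⟨C₁, hC₁, h₁⟩ := exists_norm_sub_le_add_mul hΦ M a hε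
  obtain ⟨C₂, hC₂, h₂⟩ := exists_norm_sub_le_add_mul hΦ M b hε
  set C := ENNReal.ofReal (C₁ + C₂)
  have hlim : Tendsto (fun ℓ : ℝ => C * ∫⁻ z in Metric.ball (0 : Space d) 1,
      ‖g (x + ℓ • z) - jumpProfile a b n z‖ₑ) (𝓝[>] 0) (𝓝 0) := by
    simpa using ENNReal.Tendsto.const_mul h (Or.inr ENNReal.ofReal_ne_top)
  filter_upwards [eventually_ball_subset hx,
    ENNReal.tendsto_nhds_zero.1 hlim _ (ENNReal.half_pos hη.ne')] with ℓ hℓ hsmall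
  refine le_trans ?_ ((add_le_add hεω hsmall).trans (ENNReal.add_halves η).le)
  have hω' : ω = (ENNReal.ofReal (ℓ ^ d))⁻¹ * volume (Metric.ball x ℓ) := by
    simpa [ω] using setLIntegral_ball_comp_affine (fun _ => 1) x hℓ.1
  rw [hω', setLIntegral_blowUp_jumpProfile (fun y => Φ (g y)) x _ _ n hℓ.1,
    setLIntegral_blowUp_jumpProfile g x a b n hℓ.1, mul_left_comm, mul_left_comm C, ← mul_add]
  gcongr
  rw [← lintegral_const_mul' _ _ ENNReal.ofReal_ne_top, ← setLIntegral_const,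
    ← lintegral_add_left measurable_const]
  refine lintegral_mono_ae ?_
  filter_upwards [ae_restrict_of_ae_restrict_of_subset hℓ.2 hM] with y hy
  have key : ‖Φ (g y) - jumpProfile (Φ a) (Φ b) n (y - x)‖ ≤
      ε + (C₁ + C₂) * ‖g y - jumpProfile a b n (y - x)‖ := by
    unfold jumpProfile
    split_ifs
    · refine (h₁ _ hy).trans ?_
      gcongr
      linarith
    · refine (h₂ _ hy).trans ?_
      gcongr
      linarith
  rw [← ofReal_norm, ← ofReal_norm, ← ENNReal.ofReal_mul (by positivity),
    ← ENNReal.ofReal_add hε.le (by positivity)]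
  exact ENNReal.ofReal_le_ofReal key

end BlowUpCalculus

section RadialBump

variable {d : ℕ}

/-- A smooth radial function supported in the closed ball of radius `1/√2`. -/
noncomputable def radialBump (z : Space d) : ℝ := Real.smoothTransition (1 / 2 - ‖z‖ ^ 2)

/-- The gradient of `radialBump`. -/
noncomputable def radialBumpGrad (z : Space d) : Space d :=
  (-2 * deriv Real.smoothTransition (1 / 2 - ‖z‖ ^ 2)) • z

theorem contDiff_radialBump : ContDiff ℝ (⊤ : ℕ∞) (radialBump (d := d)) :=
  Real.smoothTransition.contDiff.comp (contDiff_const.sub (contDiff_norm_sq ℝ))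

theorem hasGradientAt_radialBump (z : Space d) :
    HasGradientAt radialBump (radialBumpGrad z) z := by
  have h1 : HasDerivAt Real.smoothTransition
      (deriv Real.smoothTransition (1 / 2 - ‖z‖ ^ 2)) (1 / 2 - ‖z‖ ^ 2) :=
    ((Real.smoothTransition.contDiff (n := 1)).differentiable (by simp) _).hasDerivAt
  have h2 : HasFDerivAt (fun z : Space d => 1 / 2 - ‖z‖ ^ 2) (-(2 • innerSL ℝ z)) z :=
    (hasStrictFDerivAt_norm_sq z).hasFDerivAt.const_sub _
  rw [hasGradientAt_iff_hasFDerivAt]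
  have h3 : (InnerProductSpace.toDual ℝ (Space d)) (radialBumpGrad z) =
      deriv Real.smoothTransition (1 / 2 - ‖z‖ ^ 2) • -(2 • innerSL ℝ z) := by
    ext v
    simp only [InnerProductSpace.toDual_apply_apply, radialBumpGrad, real_inner_smul_left,
      smul_apply, neg_apply, innerSL_apply_apply, two_smul,
      add_apply, smul_eq_mul]
    ring
  rw [h3]
  exact h1.comp_hasFDerivAt z h2

theorem continuous_radialBumpGrad : Continuous (radialBumpGrad (d := d)) := by
  have : Continuous (deriv Real.smoothTransition) :=
    (Real.smoothTransition.contDiff (n := 1)).continuous_deriv le_rfl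
  unfold radialBumpGrad
  fun_prop

theorem radialBump_eq_zero {z : Space d} (hz : 1 ≤ ‖z‖) : radialBump z = 0 :=
  Real.smoothTransition.zero_of_nonpos (by nlinarith)

theorem radialBumpGrad_eq_zero {z : Space d} (hz : 1 ≤ ‖z‖) : radialBumpGrad z = 0 := by
  have h : Real.smoothTransition =ᶠ[𝓝 (1 / 2 - ‖z‖ ^ 2)] fun _ => 0 := by
    filter_upwards [Iio_mem_nhds (show 1 / 2 - ‖z‖ ^ 2 < 0 by nlinarith)] with t ht
    exact Real.smoothTransition.zero_of_nonpos (le_of_lt ht)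
  rw [radialBumpGrad, h.deriv_eq, deriv_const, mul_zero, zero_smul]

theorem abs_radialBump_le (z : Space d) : |radialBump z| ≤ 1 := by
  rw [radialBump, abs_of_nonneg (Real.smoothTransition.nonneg _)]
  exact Real.smoothTransition.le_one _

theorem hasCompactSupport_radialBumpGrad : HasCompactSupport (radialBumpGrad (d := d)) :=
  HasCompactSupport.intro (isCompact_closedBall (0 : Space d) 1) fun z hz =>
    radialBumpGrad_eq_zero (by simpa using (not_le.1 (mt mem_closedBall_zero_iff.2 hz)).le)

theorem integrable_radialBumpGrad : Integrable (radialBumpGrad (d := d)) :=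
  continuous_radialBumpGrad.integrable_of_hasCompactSupport hasCompactSupport_radialBumpGrad

theorem integral_radialBumpGrad : ∫ z : Space d, radialBumpGrad z = 0 := by
  have h := integral_neg_eq_self (radialBumpGrad (d := d)) volume
  have h2 : ∀ z : Space d, radialBumpGrad (-z) = -radialBumpGrad z := fun z => by
    simp [radialBumpGrad]
  simp_rw [h2, integral_neg] at h
  have h3 : (2 : ℝ) • ∫ z : Space d, radialBumpGrad z = 0 := by
    rw [two_smul]
    nth_rw 1 [← h]
    exact neg_add_cancel _
  exact (smul_eq_zero.1 h3).resolve_left two_ne_zero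

/-- The integral of the gradient of the radial bump over the half-space `{⟨z,n⟩ ≥ 0}` is a nonzero
multiple of `n`: it is fixed by the reflection in the line spanned by `n`, and its normal component
has a sign. -/
theorem setIntegral_radialBumpGrad_halfSpace {n : Space d} (hn : ‖n‖ = 1) :
    ∃ α : ℝ, α ≠ 0 ∧ ∫ z in {z : Space d | 0 ≤ ⟪z, n⟫}, radialBumpGrad z = α • n := by
  set H := {z : Space d | 0 ≤ ⟪z, n⟫}
  have hH : MeasurableSet H := measurableSet_le measurable_const (by fun_prop)
  set I := ∫ z in H, radialBumpGrad z
  set R := (ℝ ∙ n).reflection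
  have hR : ∀ z, R z = 2 • (⟪n, z⟫ • n) - z := fun z => by
    rw [Submodule.reflection_singleton_apply, hn]; simp
  have hRI : R I = I := by
    have h1 : ∫ z in R ⁻¹' H, radialBumpGrad (R z) = I :=
      (R.measurePreserving).setIntegral_preimage_emb
        R.toHomeomorph.measurableEmbedding _ _
    have h2 : R ⁻¹' H = H := by
      ext z
      simp only [H, mem_preimage, mem_ofPred_eq, hR, inner_sub_left, real_inner_smul_left, two_smul,
        inner_add_left, real_inner_self_eq_norm_sq, hn, real_inner_comm z n]
      constructor <;> intro h <;> linarith
    have h3 : ∀ z, radialBumpGrad (R z) = R (radialBumpGrad z) := fun z => by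
      simp [radialBumpGrad]
    rw [h2] at h1
    simp_rw [h3] at h1
    exact (R.toContinuousLinearEquiv.toContinuousLinearMap.integral_comp_comm
      integrable_radialBumpGrad.integrableOn).symm.trans h1
  refine ⟨⟪n, I⟫, ?_, ?_⟩
  · have hI : ⟪n, I⟫ = -∫ z in H, -⟪n, radialBumpGrad z⟫ := by
      rw [integral_neg, neg_neg]
      exact (integral_inner integrable_radialBumpGrad.integrableOn n).symm
    rw [hI, neg_ne_zero]
    refine ne_of_gt ?_
    have hform : ∀ z, -⟪n, radialBumpGrad z⟫ =
        2 * deriv Real.smoothTransition (1 / 2 - ‖z‖ ^ 2) * ⟪z, n⟫ := fun z => by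
      rw [radialBumpGrad, real_inner_smul_right, real_inner_comm]; ring
    have hderiv : ∀ t, 0 ≤ deriv Real.smoothTransition t := fun t =>
      Real.smoothTransition.monotone.deriv_nonneg
    have hint : IntegrableOn (fun z => -⟪n, radialBumpGrad z⟫) H :=
      (integrable_radialBumpGrad.integrableOn.const_inner n).neg
    rw [setIntegral_pos_iff_support_of_nonneg_ae _ hint]
    · obtain ⟨c, hc, hslope⟩ := exists_deriv_eq_slope Real.smoothTransition
        (show (0 : ℝ) < 1 / 2 by norm_num) Real.smoothTransition.continuous.continuousOn
        ((Real.smoothTransition.contDiff (n := 1)).differentiable (by simp)).differentiableOn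
      have hpos : 0 < deriv Real.smoothTransition c := by
        rw [hslope, Real.smoothTransition.zero, sub_zero, sub_zero]
        exact div_pos (Real.smoothTransition.pos_of_pos (by norm_num)) (by norm_num)
      have hcont : Continuous fun z : Space d => -⟪n, radialBumpGrad z⟫ := by
        have := continuous_radialBumpGrad (d := d)
        fun_prop
      have hopen : IsOpen ((fun z : Space d => -⟪n, radialBumpGrad z⟫) ⁻¹' Ioi 0 ∩
          {z | 0 < ⟪z, n⟫}) :=
        (hcont.isOpen_preimage _ isOpen_Ioi).inter (isOpen_lt continuous_const (by fun_prop))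
      refine (hopen.measure_pos volume ⟨√(1 / 2 - c) • n, ?_⟩).trans_le
        (measure_mono fun z hz => ⟨ne_of_gt hz.1, show 0 ≤ ⟪z, n⟫ from le_of_lt hz.2⟩)
      have hs : 0 < √(1 / 2 - c) := Real.sqrt_pos.2 (by linarith [hc.2])
      have hin : ⟪√(1 / 2 - c) • n, n⟫ = √(1 / 2 - c) := by
        rw [real_inner_smul_left, real_inner_self_eq_norm_sq, hn]; ring
      refine ⟨?_, by rw [mem_ofPred_eq, hin]; exact hs⟩
      rw [mem_preimage, mem_Ioi, hform, hin, norm_smul, hn, mul_one, Real.norm_of_nonneg hs.le,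
        Real.sq_sqrt (by linarith [hc.2]), sub_sub_cancel]
      positivity
    · filter_upwards [ae_restrict_mem hH] with z hz
      rw [Pi.zero_apply, hform]
      exact mul_nonneg (mul_nonneg zero_le_two (hderiv _)) hz
  · have h1 := hR I
    rw [hRI, eq_sub_iff_add_eq, ← two_smul ℕ I] at h1
    have h2 : (2 : ℝ) • I = (2 : ℝ) • (⟪n, I⟫ • n) := by
      rw [two_smul, two_smul]; rw [two_smul, two_smul] at h1; exact h1
    exact smul_right_injective _ (two_ne_zero (α := ℝ)) h2

end RadialBump

/-! ### The jump relation -/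

section JumpRelation

variable {d : ℕ} {Ω : Opens (Space d)} {F : Type*} [NormedAddCommGroup F] [NormedSpace ℝ F]

theorem RadonMeasure.enorm_integral_le (lam : RadonMeasure Ω F) {ψ : Space d → ℝ} {K : Set (Space d)}
    (hK : MeasurableSet K) (h1 : ∀ y, |ψ y| ≤ 1) (h0 : ∀ y ∉ K, ψ y = 0) :
    ‖lam.integral ψ‖ₑ ≤ lam.variation K := by
  refine (enorm_integral_le_lintegral_enorm _).trans ?_
  rw [← lintegral_indicator_one hK]
  refine lintegral_mono_ae ?_
  filter_upwards [lam.norm_direction] with y hy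
  by_cases hyK : y ∈ K
  · rw [indicator_of_mem hyK, ← ofReal_norm, norm_smul, hy, mul_one]
    exact (ENNReal.ofReal_le_ofReal (h1 y)).trans (by simp)
  · simp [h0 y hyK]

theorem integral_jumpProfile_radialBumpGrad [CompleteSpace F] (Wp Wm : Space d →L[ℝ] F)
    {n : Space d} (hn : ‖n‖ = 1) : ∃ α : ℝ, α ≠ 0 ∧
      ∫ z, jumpProfile Wp Wm n z (radialBumpGrad z) = α • (Wp n - Wm n) := by
  obtain ⟨α, hα, hI⟩ := setIntegral_radialBumpGrad_halfSpace hn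
  refine ⟨α, hα, ?_⟩
  set H := {z : Space d | 0 ≤ ⟪z, n⟫}
  have hH : MeasurableSet H := measurableSet_le measurable_const (by fun_prop)
  have hint := integrable_radialBumpGrad (d := d)
  have hsplit : ∀ z, jumpProfile Wp Wm n z (radialBumpGrad z) =
      Wm (radialBumpGrad z) + H.indicator (fun z => (Wp - Wm) (radialBumpGrad z)) z := by
    intro z
    by_cases hz : 0 ≤ ⟪z, n⟫
    · rw [indicator_of_mem (show z ∈ H from hz), jumpProfile, if_pos hz]; simp
    · rw [indicator_of_notMem (show z ∉ H from hz), jumpProfile, if_neg hz]; simp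
  simp_rw [hsplit]
  rw [integral_add (Wm.integrable_comp hint) (((Wp - Wm).integrable_comp hint).indicator hH),
    integral_indicator hH, Wm.integral_comp_comm hint,
    (Wp - Wm).integral_comp_comm hint.integrableOn, integral_radialBumpGrad, hI]
  simp

theorem aestronglyMeasurable_clm_apply {α E : Type*} [MeasurableSpace α] [NormedAddCommGroup E]
    [NormedSpace ℝ E] {m : Measure α} {W : α → E →L[ℝ] F} {v : α → E}
    (hW : AEStronglyMeasurable W m) (hv : AEStronglyMeasurable v m) :
    AEStronglyMeasurable (fun y => W y (v y)) m :=
  (ContinuousLinearMap.id ℝ (E →L[ℝ] F)).aestronglyMeasurable_comp₂ hW hv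

/-- The jump relation. If `-div W + h` is a Radon measure which has zero
`(d-1)`-dimensional density at `x`, and so has `h`, then the normal component of `W` does not jump
at `x`. The equation is only needed for the rescalings of one radial test function. -/
theorem jump_relation [CompleteSpace F] {W : Space d → Space d →L[ℝ] F} {h : Space d → F}
    {lam : RadonMeasure Ω F} {x n : Space d} (hx : x ∈ Ω) (hn : ‖n‖ = 1) {M : ℝ}
    (hW : AEStronglyMeasurable W (volume.restrict Ω))
    (hWM : ∀ᵐ y ∂volume.restrict (Ω : Set (Space d)), ‖W y‖ ≤ M) (hh : IntegrableOn h Ω)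
    (heq : ∀ k : ℕ, Metric.closedBall x (1 / ((k : ℝ) + 1)) ⊆ Ω →
      ∫ y in (Ω : Set (Space d)),
        (W y (((k : ℝ) + 1) • radialBumpGrad (((k : ℝ) + 1) • (y - x)))
          + radialBump (((k : ℝ) + 1) • (y - x)) • h y) =
        lam.integral fun y => radialBump (((k : ℝ) + 1) • (y - x)))
    (hlam : Tendsto (fun r : ℝ => lam.variation (Metric.closedBall x r) /
      ENNReal.ofReal r ^ ((d : ℝ) - 1)) (𝓝[>] 0) (𝓝 0))
    (hhd : Tendsto (fun r : ℝ => (volume.restrict (Ω : Set (Space d))).withDensity (fun y => ‖h y‖ₑ)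
      (Metric.closedBall x r) / ENNReal.ofReal r ^ ((d : ℝ) - 1)) (𝓝[>] 0) (𝓝 0))
    {Wp Wm : Space d →L[ℝ] F} (hbl : HasOneSidedLimits W x n Wp Wm) : Wp n = Wm n := by
  obtain ⟨α, hα, hL⟩ := integral_jumpProfile_radialBumpGrad Wp Wm hn
  set J := jumpProfile Wp Wm n with hJ
  set L := ∫ z, J z (radialBumpGrad z)
  -- `L` is the limit of the rescaled principal terms; it is a nonzero multiple of the normal jump
  suffices hL0 : ‖L‖ₑ = 0 by
    rw [enorm_eq_zero, hL] at hL0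
    exact sub_eq_zero.1 ((smul_eq_zero.1 hL0).resolve_left hα)
  obtain ⟨C, hC⟩ := (continuous_radialBumpGrad (d := d)).bounded_above_of_compact_support
    hasCompactSupport_radialBumpGrad
  have hlim : Tendsto (fun r : ℝ =>
      lam.variation (Metric.closedBall x r) / ENNReal.ofReal r ^ ((d : ℝ) - 1) +
      ENNReal.ofReal C * (∫⁻ z in Metric.ball (0 : Space d) 1, ‖W (x + r • z) - J z‖ₑ) +
      (volume.restrict (Ω : Set (Space d))).withDensity (fun y => ‖h y‖ₑ)
        (Metric.closedBall x r) / ENNReal.ofReal r ^ ((d : ℝ) - 1)) (𝓝[>] 0) (𝓝 0) := by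
    simpa using (hlam.add (ENNReal.Tendsto.const_mul hbl (Or.inr ENNReal.ofReal_ne_top))).add hhd
  have hseq : Tendsto (fun k : ℕ => 1 / ((k : ℝ) + 1)) atTop (𝓝[>] 0) :=
    tendsto_nhdsWithin_iff.2 ⟨tendsto_one_div_add_atTop_nhds_zero_nat,
      Eventually.of_forall fun k => show (0 : ℝ) < 1 / ((k : ℝ) + 1) by positivity⟩
  refine le_antisymm (ge_of_tendsto (hlim.comp hseq) ?_) bot_le
  have hev : ∀ᶠ ℓ in 𝓝[>] (0 : ℝ), Metric.closedBall x ℓ ⊆ Ω := by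
    obtain ⟨ε, hε, hb⟩ := Metric.isOpen_iff.1 Ω.isOpen x hx
    filter_upwards [Ioo_mem_nhdsGT hε] with ℓ hℓ
    exact (Metric.closedBall_subset_ball hℓ.2).trans hb
  filter_upwards [hseq.eventually hev] with k hk
  specialize heq k hk
  simp only [Function.comp_apply]
  set s : ℝ := (k : ℝ) + 1 with hs
  have hs0 : 0 < s := by positivity
  set ℓ : ℝ := 1 / s with hℓ
  have hℓ0 : 0 < ℓ := by positivity
  have hsℓ : s * ℓ = 1 := by rw [hℓ]; field_simp
  set B := Metric.ball x ℓ
  have hBΩ : B ⊆ Ω := Metric.ball_subset_closedBall.trans hk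
  have hBm : MeasurableSet B := Metric.isOpen_ball.measurableSet
  have hout : ∀ y ∉ B, 1 ≤ ‖s • (y - x)‖ := by
    intro y hy
    rw [mem_ball_iff_norm, not_lt] at hy
    rw [norm_smul, Real.norm_of_nonneg hs0.le, ← hsℓ]
    gcongr
  set V : Space d → Space d := fun y => s • radialBumpGrad (s • (y - x)) with hV
  set ψ : Space d → ℝ := fun y => radialBump (s • (y - x)) with hψ
  have hV0 : ∀ y ∉ B, V y = 0 := fun y hy => by
    rw [hV]; simp only; rw [radialBumpGrad_eq_zero (hout y hy), smul_zero]
  have hψ0 : ∀ y ∉ B, ψ y = 0 := fun y hy => radialBump_eq_zero (hout y hy)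
  have hVc : Continuous V := by
    have := continuous_radialBumpGrad (d := d)
    fun_prop
  have hψc : Continuous ψ := by
    have := (contDiff_radialBump (d := d)).continuous
    fun_prop
  have hVC : ∀ y, ‖V y‖ ≤ s * C := fun y => by
    rw [hV]; simp only
    rw [norm_smul, Real.norm_of_nonneg hs0.le]
    gcongr
    exact hC _
  have hC0 : 0 ≤ C := (norm_nonneg _).trans (hC 0)
  have hfinB : IsFiniteMeasure (volume.restrict B) := ⟨by
    rw [Measure.restrict_apply_univ]; exact measure_ball_lt_top⟩
  have hrestr : volume.restrict B ≤ volume.restrict (Ω : Set (Space d)) :=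
    Measure.restrict_mono hBΩ le_rfl
  have hJm : AEStronglyMeasurable (fun y => J (y - x)) (volume.restrict B) :=
    ((stronglyMeasurable_jumpProfile Wp Wm n).comp_measurable
      (measurable_id.sub_const x)).aestronglyMeasurable
  have hWB := hW.mono_measure hrestr
  have hJb : ∀ z, ‖J z‖ ≤ max ‖Wp‖ ‖Wm‖ := fun z => by
    rw [hJ]; unfold jumpProfile; split_ifs
    exacts [le_max_left _ _, le_max_right _ _]
  have hint1 : Integrable (fun y => J (y - x) (V y)) (volume.restrict B) := by
    refine Integrable.of_bound
      (aestronglyMeasurable_clm_apply hJm hVc.aestronglyMeasurable) (max ‖Wp‖ ‖Wm‖ * (s * C))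
      (Eventually.of_forall fun y => ?_)
    exact (ContinuousLinearMap.le_of_opNorm_le _ (hJb _) _).trans
      (mul_le_mul_of_nonneg_left (hVC y) ((norm_nonneg _).trans (hJb 0)))
  have hint2 : Integrable (fun y => W y (V y)) (volume.restrict B) := by
    refine Integrable.of_bound
      (aestronglyMeasurable_clm_apply hWB hVc.aestronglyMeasurable) (M * (s * C)) ?_
    filter_upwards [ae_restrict_of_ae_restrict_of_subset hBΩ hWM] with y hy
    exact (ContinuousLinearMap.le_of_opNorm_le _ hy _).trans
      (mul_le_mul_of_nonneg_left (hVC y) ((norm_nonneg _).trans hy))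
  have hhB : Integrable h (volume.restrict B) := hh.mono_set hBΩ
  have hint3 : Integrable (fun y => ψ y • h y) (volume.restrict B) :=
    hhB.bdd_smul 1 hψc.aestronglyMeasurable (Eventually.of_forall fun y => abs_radialBump_le _)
  have heqB : ∫ y in B, (W y (V y) + ψ y • h y) = lam.integral ψ := by
    rw [← heq]
    refine (setIntegral_eq_of_subset_of_forall_sdiff_eq_zero Ω.isOpen.measurableSet hBΩ
      fun y hy => ?_).symm
    rw [hV0 y hy.2, hψ0 y hy.2]; simp
  set P : ℝ≥0∞ := ENNReal.ofReal ℓ ^ ((d : ℝ) - 1) with hP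
  have hPeq : P = ENNReal.ofReal ((s ^ d)⁻¹ * s) := by
    rw [hP, ENNReal.ofReal_rpow_of_pos hℓ0, Real.rpow_sub_one hℓ0.ne', Real.rpow_natCast, hℓ, one_div,
      inv_pow]
    congr 1
    field_simp
  have hP0 : P ≠ 0 := by rw [hPeq, ne_eq, ENNReal.ofReal_eq_zero, not_le]; positivity
  have hPt : P ≠ ∞ := by rw [hPeq]; exact ENNReal.ofReal_ne_top
  -- scaling of the principal term
  have hscale : ∫ y in B, J (y - x) (V y) = ((s ^ d)⁻¹ * s) • L := by
    rw [setIntegral_eq_integral_of_forall_compl_eq_zero fun y hy => by rw [hV0 y hy]; simp]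
    have h1 : ∀ y, J (y - x) (V y) = (fun y => s • J (s • y) (radialBumpGrad (s • y))) (y - x) :=
      fun y => by simp only [hV, map_smul, hJ, jumpProfile_smul Wp Wm n hs0]
    simp_rw [h1]
    rw [integral_sub_right_eq_self (fun y => s • J (s • y) (radialBumpGrad (s • y))) x,
      integral_smul, Measure.integral_comp_smul volume (fun y => J y (radialBumpGrad y)) s,
      finrank_euclideanSpace_fin, abs_of_pos (by positivity), smul_smul, mul_comm s]
  have hdecomp : ((s ^ d)⁻¹ * s) • L = lam.integral ψ +
      ∫ y in B, (J (y - x) (V y) - (W y (V y) + ψ y • h y)) := by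
    have h1 : ∫ y in B, (J (y - x) (V y) - (W y (V y) + ψ y • h y)) =
        (∫ y in B, J (y - x) (V y)) - ∫ y in B, (W y (V y) + ψ y • h y) :=
      integral_sub hint1 (hint2.add hint3)
    rw [h1, hscale, heqB]; abel
  have hremainder : ‖∫ y in B, (J (y - x) (V y) - (W y (V y) + ψ y • h y))‖ₑ ≤
      ENNReal.ofReal (s * C) * (∫⁻ y in B, ‖W y - J (y - x)‖ₑ) + ∫⁻ y in B, ‖h y‖ₑ := by
    refine (enorm_integral_le_lintegral_enorm _).trans ?_
    rw [← lintegral_const_mul' _ _ ENNReal.ofReal_ne_top, ← lintegral_add_right' _ hhB.1.enorm]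
    refine lintegral_mono fun y => ?_
    simp_rw [← ofReal_norm]
    rw [← ENNReal.ofReal_mul (by positivity), ← ENNReal.ofReal_add (by positivity) (norm_nonneg _)]
    refine ENNReal.ofReal_le_ofReal ?_
    have e1 : J (y - x) (V y) - (W y (V y) + ψ y • h y) =
        -((W y - J (y - x)) (V y)) - ψ y • h y := by
      simp only [sub_apply]; abel
    rw [e1]
    refine (norm_sub_le _ _).trans (add_le_add ?_ ?_)
    · rw [norm_neg, mul_comm]
      exact ((W y - J (y - x)).le_opNorm _).trans (by gcongr; exact hVC y)
    · rw [norm_smul]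
      exact mul_le_of_le_one_left (norm_nonneg _) (abs_radialBump_le _)
  have hhw : ∫⁻ y in B, ‖h y‖ₑ ≤ (volume.restrict (Ω : Set (Space d))).withDensity
      (fun y => ‖h y‖ₑ) (Metric.closedBall x ℓ) := by
    rw [withDensity_apply _ Metric.isClosed_closedBall.measurableSet,
      Measure.restrict_restrict_of_subset hk]
    exact lintegral_mono_set Metric.ball_subset_closedBall
  have hmain : P * ‖L‖ₑ ≤ lam.variation (Metric.closedBall x ℓ) +
      (ENNReal.ofReal (s * C) * (∫⁻ y in B, ‖W y - J (y - x)‖ₑ) +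
        (volume.restrict (Ω : Set (Space d))).withDensity (fun y => ‖h y‖ₑ)
          (Metric.closedBall x ℓ)) := by
    have h1 : P * ‖L‖ₑ = ‖((s ^ d)⁻¹ * s) • L‖ₑ := by
      rw [hPeq, enorm_smul, Real.enorm_of_nonneg (by positivity)]
    rw [h1, hdecomp]
    refine (enorm_add_le _ _).trans (add_le_add ?_ (hremainder.trans (by gcongr)))
    exact lam.enorm_integral_le Metric.isClosed_closedBall.measurableSet
      (fun y => abs_radialBump_le _)
      fun y hy => hψ0 y fun hyB => hy (Metric.ball_subset_closedBall hyB)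
  have hW2 : ENNReal.ofReal (s * C) * (∫⁻ y in B, ‖W y - J (y - x)‖ₑ) / P =
      ENNReal.ofReal C * ∫⁻ z in Metric.ball (0 : Space d) 1, ‖W (x + ℓ • z) - J z‖ₑ := by
    rw [setLIntegral_blowUp_jumpProfile W x Wp Wm n hℓ0]
    have h2 : P⁻¹ * ENNReal.ofReal s = (ENNReal.ofReal (ℓ ^ d))⁻¹ := by
      rw [hPeq, ← ENNReal.ofReal_inv_of_pos (by positivity), ← ENNReal.ofReal_mul (by positivity),
        ← ENNReal.ofReal_inv_of_pos (by positivity), hℓ, one_div, inv_pow]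
      congr 1
      field_simp
    rw [← h2, ENNReal.ofReal_mul hs0.le, div_eq_mul_inv]
    ring
  rw [← hW2, add_assoc, ← ENNReal.add_div, ← ENNReal.add_div,
    ENNReal.le_div_iff_mul_le (Or.inl hP0) (Or.inl hPt), mul_comm]
  exact hmain

end JumpRelation

/-! ### Slicing a balance law in time -/

section Slicing

variable {d : ℕ} {T : ℝ} {Ω : Opens (Space d)} {F : Type*} [NormedAddCommGroup F] [NormedSpace ℝ F]

theorem volume_restrict_cylinder (T : ℝ) (Ω : Opens (Space d)) :
    volume.restrict (cylinder T Ω : Set (ℝ × Space d)) =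
      (volume.restrict (Ioo 0 T)).prod (volume.restrict (Ω : Set (Space d))) := by
  rw [Measure.prod_restrict, ← Measure.volume_eq_prod]; rfl

theorem exists_ae_norm_le_of_memLp_top {α : Type*} [MeasurableSpace α] {G : Type*}
    [NormedAddCommGroup G] {m : Measure α} {f : α → G} (hf : MemLp f ∞ m) : ∃ M : ℝ, ∀ᵐ y ∂m, ‖f y‖ ≤ M := by
  refine ⟨(eLpNorm f ∞ m).toReal, ?_⟩
  have h := hf.2.ne
  rw [eLpNorm_exponent_top] at h ⊢
  filter_upwards [ae_le_eLpNormEssSup (f := f) (μ := m)] with y hy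
  rw [← toReal_enorm]
  exact ENNReal.toReal_mono h hy

/-- The tensor product `(t, x) ↦ θ(t) ψ(x)` of test functions on `(0,T)` and on `Ω`. -/
def tensorTest (θ : ℝ → ℝ) (ψ : Space d → ℝ) (q : ℝ × Space d) : ℝ := θ q.1 * ψ q.2

variable {θ : ℝ → ℝ} {ψ : Space d → ℝ}

theorem timeDeriv_tensorTest (q : ℝ × Space d) :
    timeDeriv (tensorTest θ ψ) q = deriv θ q.1 * ψ q.2 := by
  simp [timeDeriv, tensorTest]

theorem spaceGrad_tensorTest (hψ : Differentiable ℝ ψ) (q : ℝ × Space d) :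
    spaceGrad (tensorTest θ ψ) q = θ q.1 • gradient ψ q.2 := by
  have h := (hψ q.2).hasGradientAt
  rw [hasGradientAt_iff_hasFDerivAt] at h
  refine HasGradientAt.gradient (hasGradientAt_iff_hasFDerivAt.2 ?_)
  rw [map_smul]
  exact h.const_mul (θ q.1)

theorem hasCompactSupport_tensorTest (hθ : HasCompactSupport θ) (hψ : HasCompactSupport ψ) :
    HasCompactSupport (tensorTest θ ψ) :=
  HasCompactSupport.intro (hθ.isCompact.prod hψ.isCompact) fun q hq => by
    rw [mem_prod, not_and_or] at hq
    rcases hq with hq | hq <;> simp [tensorTest, image_eq_zero_of_notMem_tsupport hq]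

theorem tsupport_tensorTest_subset (hθ : tsupport θ ⊆ Ioo 0 T) (hψ : tsupport ψ ⊆ Ω) :
    tsupport (tensorTest θ ψ) ⊆ (cylinder T Ω : Set (ℝ × Space d)) := by
  have h : tsupport (tensorTest θ ψ) ⊆ tsupport θ ×ˢ tsupport ψ := by
    refine closure_minimal (fun q hq => ?_) ((isClosed_tsupport θ).prod (isClosed_tsupport ψ))
    exact ⟨subset_tsupport _ (left_ne_zero_of_mul hq), subset_tsupport _ (right_ne_zero_of_mul hq)⟩
  exact h.trans (prod_mono hθ hψ)

theorem contDiff_tensorTest {k : WithTop ℕ∞} (hθ : ContDiff ℝ k θ) (hψ : ContDiff ℝ k ψ) :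
    ContDiff ℝ k (tensorTest θ ψ) :=
  (hθ.comp contDiff_fst).mul (hψ.comp contDiff_snd)

theorem RadonMeasure.integral_const_mul (lam : RadonMeasure Ω F) (c : ℝ) (ψ : Space d → ℝ) :
    (lam.integral fun x => c * ψ x) = c • lam.integral ψ := by
  simp_rw [RadonMeasure.integral, mul_smul]
  rw [integral_smul]

theorem continuous_gradient (hψ : ContDiff ℝ 1 ψ) : Continuous (gradient ψ) :=
  (InnerProductSpace.toDual ℝ (Space d)).symm.continuous.comp (hψ.continuous_fderiv one_ne_zero)

theorem hasCompactSupport_gradient (hψ : HasCompactSupport ψ) :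
    HasCompactSupport (gradient ψ) :=
  (hψ.fderiv (𝕜 := ℝ)).comp_left (g := (InnerProductSpace.toDual ℝ (Space d)).symm) (map_zero _)

/-- For a fixed test function `ψ` on `Ω`, a balance law `∂ₜ w + div W = h`, tested on
`(0,T) × Ω`, whose time derivative disintegrates as `μₜ ⊗ dt`, holds at almost every time. -/
theorem ae_balance_law_of_test [CompleteSpace F] {w : ℝ → Space d → F}
    {W : ℝ → Space d → Space d →L[ℝ] F} {h : ℝ → Space d → F}
    (hw : MemLp (fun q : ℝ × Space d => w q.1 q.2) ∞
      (volume.restrict (cylinder T Ω : Set (ℝ × Space d))))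
    (hW : MemLp (fun q : ℝ × Space d => W q.1 q.2) ∞
      (volume.restrict (cylinder T Ω : Set (ℝ × Space d))))
    (hh : IntegrableOn (fun q : ℝ × Space d => h q.1 q.2) (cylinder T Ω))
    (heq : ∀ φ : 𝓓(cylinder T Ω, ℝ), ∫ q in (cylinder T Ω : Set (ℝ × Space d)),
      (timeDeriv φ q • w q.1 q.2 + W q.1 q.2 (spaceGrad φ q) + φ q • h q.1 q.2) = 0)
    {μ : RadonMeasure (cylinder T Ω) F} {μt : ℝ → RadonMeasure Ω F}
    (hμ : IsTimeDerivative T Ω w μ) (hμt : DisintegratesInTime T Ω μ μt)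
    (hψ : ContDiff ℝ (⊤ : ℕ∞) ψ) (hψc : HasCompactSupport ψ) (hψΩ : tsupport ψ ⊆ Ω) :
    ∀ᵐ t ∂volume.restrict (Ioo 0 T),
      ∫ y in (Ω : Set (Space d)), (W t y (gradient ψ y) + ψ y • h t y) = (μt t).integral ψ := by
  obtain ⟨Mw, hMw⟩ := exists_ae_norm_le_of_memLp_top hw
  obtain ⟨MW, hMW⟩ := exists_ae_norm_le_of_memLp_top hW
  have hgc : Continuous (gradient ψ) := continuous_gradient (hψ.of_le (by simp))
  have hgs : HasCompactSupport (gradient ψ) := hasCompactSupport_gradient hψc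
  obtain ⟨Cψ, hCψ⟩ := hψ.continuous.bounded_above_of_compact_support hψc
  have hdiff : Differentiable ℝ ψ := hψ.differentiable (by simp)
  set H : ℝ × Space d → F := fun q => W q.1 q.2 (gradient ψ q.2) + ψ q.2 • h q.1 q.2
  have hH : IntegrableOn H (cylinder T Ω) := by
    have hfin : IsFiniteMeasure (volume.restrict (Ioo 0 T)) := ⟨by simp⟩
    refine Integrable.add ?_ ?_
    · have h1 : Integrable (fun q : ℝ × Space d => MW * ‖gradient ψ q.2‖)
          (volume.restrict (cylinder T Ω : Set (ℝ × Space d))) := by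
        rw [volume_restrict_cylinder]
        exact (((hgc.integrable_of_hasCompactSupport hgs).integrableOn.norm).comp_snd _).const_mul _
      refine h1.mono' (aestronglyMeasurable_clm_apply hW.1
        (hgc.comp continuous_snd).aestronglyMeasurable) ?_
      filter_upwards [hMW] with q hq
      exact ContinuousLinearMap.le_of_opNorm_le _ hq _
    · exact Integrable.bdd_smul hh Cψ (hψ.continuous.comp continuous_snd).aestronglyMeasurable
        (Eventually.of_forall fun q => hCψ q.2)
  set A : ℝ → F := fun t => ∫ y in (Ω : Set (Space d)), H (t, y)
  set b : ℝ → F := fun t => (μt t).integral ψ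
  have hH' : Integrable H
      ((volume.restrict (Ioo 0 T)).prod (volume.restrict (Ω : Set (Space d)))) := by
    rw [← volume_restrict_cylinder]; exact hH
  have hA : IntegrableOn A (Ioo 0 T) := hH'.integral_prod_left
  have htest : ∀ θ : ℝ → ℝ, ContDiff ℝ (⊤ : ℕ∞) θ → HasCompactSupport θ → tsupport θ ⊆ Ioo 0 T →
      IntegrableOn (fun t => θ t • b t) (Ioo 0 T) ∧
        ∫ t in Ioo 0 T, θ t • A t = ∫ t in Ioo 0 T, θ t • b t := by
    intro θ hθ hθc hθT
    let φ : 𝓓(cylinder T Ω, ℝ) := ⟨tensorTest θ ψ, contDiff_tensorTest hθ hψ,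
      hasCompactSupport_tensorTest hθc hψc, tsupport_tensorTest_subset hθT hψΩ⟩
    let φ₀ : 𝓓^{0}(cylinder T Ω, ℝ) := ⟨tensorTest θ ψ,
      contDiff_tensorTest (hθ.of_le (by simp)) (hψ.of_le (by simp)),
      hasCompactSupport_tensorTest hθc hψc, tsupport_tensorTest_subset hθT hψΩ⟩
    have hb : ∀ t, (μt t).integral (fun x => φ₀ (t, x)) = θ t • b t := fun t =>
      (μt t).integral_const_mul (θ t) ψ
    obtain ⟨h1, h2⟩ := hμt φ₀
    simp_rw [hb] at h1 h2
    refine ⟨h1, ?_⟩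
    have h3 : μ.integral φ = μ.integral φ₀ := rfl
    have hint1 : IntegrableOn (fun q : ℝ × Space d => timeDeriv φ q • w q.1 q.2)
        (cylinder T Ω) := by
      have hd : ∀ q, timeDeriv φ q = tensorTest (deriv θ) ψ q := timeDeriv_tensorTest
      have hθ' : Continuous (deriv θ) := hθ.continuous_deriv (by simp)
      have hc : Continuous (tensorTest (deriv θ) ψ) :=
        (hθ'.comp continuous_fst).mul (hψ.continuous.comp continuous_snd)
      have hi : IntegrableOn (tensorTest (deriv θ) ψ) (cylinder T Ω) :=
        (hc.integrable_of_hasCompactSupport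
          (hasCompactSupport_tensorTest hθc.deriv hψc)).integrableOn
      simp_rw [hd]
      exact Integrable.smul_bdd hi Mw hw.1 hMw
    have hint2 : IntegrableOn (fun q : ℝ × Space d => θ q.1 • H q) (cylinder T Ω) := by
      obtain ⟨Cθ, hCθ⟩ := hθ.continuous.bounded_above_of_compact_support hθc
      exact Integrable.bdd_smul hH Cθ (hθ.continuous.comp continuous_fst).aestronglyMeasurable
        (Eventually.of_forall fun q => hCθ q.1)
    have h4 : ∀ q, timeDeriv φ q • w q.1 q.2 + W q.1 q.2 (spaceGrad φ q) + φ q • h q.1 q.2 =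
        timeDeriv φ q • w q.1 q.2 + θ q.1 • H q := fun q => by
      have e1 : spaceGrad φ q = θ q.1 • gradient ψ q.2 := spaceGrad_tensorTest hdiff q
      have e2 : φ q = θ q.1 * ψ q.2 := rfl
      rw [e1, e2, map_smul, smul_add, smul_smul, add_assoc]
    have h5 := heq φ
    simp_rw [h4] at h5
    rw [integral_add hint1 hint2, add_eq_zero_iff_neg_eq, hμ φ, h3, h2] at h5
    rw [h5, volume_restrict_cylinder,
      integral_prod _ (by rw [← volume_restrict_cylinder]; exact hint2)]
    simp_rw [integral_smul]
    rfl
  -- a test function equal to one near `t` shows that `b` is integrable there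
  have hloc : LocallyIntegrableOn b (Ioo 0 T) := by
    intro t ht
    obtain ⟨ε, hε, hball⟩ := Metric.isOpen_iff.1 isOpen_Ioo t ht
    let θ : ContDiffBump t := ⟨ε / 4, ε / 2, by linarith, by linarith⟩
    have hsupp : tsupport θ ⊆ Ioo 0 T := by
      rw [θ.tsupport_eq]
      exact (Metric.closedBall_subset_ball (show ε / 2 < ε by linarith)).trans hball
    have h1 := (htest θ θ.contDiff θ.hasCompactSupport hsupp).1
    have hsub : Metric.closedBall t (ε / 4) ⊆ Ioo 0 T :=
      (Metric.closedBall_subset_ball (by linarith)).trans hball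
    refine ⟨Metric.closedBall t (ε / 4), mem_nhdsWithin_of_mem_nhds
      (Metric.closedBall_mem_nhds _ (by linarith)), ?_⟩
    refine (h1.mono_set hsub).congr_fun (fun y hy => ?_) Metric.isClosed_closedBall.measurableSet
    simp only
    rw [θ.one_of_mem_closedBall hy, one_smul]
  have hae := isOpen_Ioo.ae_eq_zero_of_integral_contDiff_smul_eq_zero
    (f := fun t => A t - b t) (hA.locallyIntegrableOn.sub hloc) (fun θ hθ hθc hθT => by
      obtain ⟨h1, h2⟩ := htest θ hθ hθc hθT
      rw [← setIntegral_eq_integral_of_forall_compl_eq_zero (s := Ioo 0 T) fun t ht => by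
        rw [image_eq_zero_of_notMem_tsupport fun h => ht (hθT h), zero_smul]]
      simp_rw [smul_sub]
      obtain ⟨Cθ, hCθ⟩ := hθ.continuous.bounded_above_of_compact_support hθc
      have h0 : IntegrableOn (fun t => θ t • A t) (Ioo 0 T) :=
        Integrable.bdd_smul hA Cθ hθ.continuous.aestronglyMeasurable (Eventually.of_forall hCθ)
      rw [integral_sub h0 h1, h2, sub_self])
  rw [ae_restrict_iff' measurableSet_Ioo]
  filter_upwards [hae] with t ht htT
  exact sub_eq_zero.1 (ht htT)

theorem gradient_radialBump_comp (s : ℝ) (x y : Space d) :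
    gradient (fun y => radialBump (s • (y - x))) y = s • radialBumpGrad (s • (y - x)) := by
  have h1 := hasGradientAt_iff_hasFDerivAt.1 (hasGradientAt_radialBump (s • (y - x)))
  have h2 : HasFDerivAt (fun y : Space d => s • (y - x)) (s • ContinuousLinearMap.id ℝ (Space d)) y :=
    ((hasFDerivAt_id y).sub_const x).const_smul s
  refine HasGradientAt.gradient (hasGradientAt_iff_hasFDerivAt.2 ?_)
  have h3 : (InnerProductSpace.toDual ℝ (Space d)) (s • radialBumpGrad (s • (y - x))) =
      ((InnerProductSpace.toDual ℝ (Space d)) (radialBumpGrad (s • (y - x)))).comp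
        (s • ContinuousLinearMap.id ℝ (Space d)) := by
    ext v
    simp
  rw [h3]
  exact h1.comp y h2

/-- At almost every time the balance law holds simultaneously for all rescaled and translated
radial bumps: countably many centres are dense, and both sides depend continuously on the
centre. -/
theorem ae_balance_law_radialBump [CompleteSpace F] {w : ℝ → Space d → F}
    {W : ℝ → Space d → Space d →L[ℝ] F} {h : ℝ → Space d → F}
    (hw : MemLp (fun q : ℝ × Space d => w q.1 q.2) ∞
      (volume.restrict (cylinder T Ω : Set (ℝ × Space d))))
    (hW : MemLp (fun q : ℝ × Space d => W q.1 q.2) ∞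
      (volume.restrict (cylinder T Ω : Set (ℝ × Space d))))
    (hh : IntegrableOn (fun q : ℝ × Space d => h q.1 q.2) (cylinder T Ω))
    (heq : ∀ φ : 𝓓(cylinder T Ω, ℝ), ∫ q in (cylinder T Ω : Set (ℝ × Space d)),
      (timeDeriv φ q • w q.1 q.2 + W q.1 q.2 (spaceGrad φ q) + φ q • h q.1 q.2) = 0)
    {μ : RadonMeasure (cylinder T Ω) F} {μt : ℝ → RadonMeasure Ω F}
    (hμ : IsTimeDerivative T Ω w μ) (hμt : DisintegratesInTime T Ω μ μt) :
    ∃ M : ℝ, ∀ᵐ t ∂volume.restrict (Ioo 0 T),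
      AEStronglyMeasurable (W t) (volume.restrict (Ω : Set (Space d))) ∧
      (∀ᵐ y ∂volume.restrict (Ω : Set (Space d)), ‖W t y‖ ≤ M) ∧
      IntegrableOn (h t) Ω ∧
      ∀ (x : Space d) (k : ℕ), Metric.closedBall x (1 / ((k : ℝ) + 1)) ⊆ Ω →
        ∫ y in (Ω : Set (Space d)),
          (W t y (((k : ℝ) + 1) • radialBumpGrad (((k : ℝ) + 1) • (y - x)))
            + radialBump (((k : ℝ) + 1) • (y - x)) • h t y) =
          (μt t).integral fun y => radialBump (((k : ℝ) + 1) • (y - x)) := by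
  obtain ⟨M, hM⟩ := exists_ae_norm_le_of_memLp_top hW
  refine ⟨M, ?_⟩
  have hWm := hW.1
  have hh' := hh
  rw [volume_restrict_cylinder] at hM hWm
  rw [IntegrableOn, volume_restrict_cylinder] at hh'
  have hout : ∀ (x y : Space d) (k : ℕ), y ∉ Metric.closedBall x (1 / ((k : ℝ) + 1)) →
      1 ≤ ‖((k : ℝ) + 1) • (y - x)‖ := by
    intro x y k hy
    rw [mem_closedBall_iff_norm, not_le, div_lt_iff₀ (by positivity)] at hy
    rw [norm_smul, Real.norm_of_nonneg (by positivity), mul_comm]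
    exact hy.le
  have hdense : ∀ᵐ t ∂volume.restrict (Ioo 0 T), ∀ (i k : ℕ),
      Metric.closedBall (denseSeq (Space d) i) (1 / ((k : ℝ) + 1)) ⊆ Ω →
        ∫ y in (Ω : Set (Space d)),
          (W t y (((k : ℝ) + 1) • radialBumpGrad (((k : ℝ) + 1) • (y - denseSeq (Space d) i)))
            + radialBump (((k : ℝ) + 1) • (y - denseSeq (Space d) i)) • h t y) =
          (μt t).integral fun y => radialBump (((k : ℝ) + 1) • (y - denseSeq (Space d) i)) := by
    simp only [ae_all_iff]
    intro i k hsub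
    set x := denseSeq (Space d) i
    set ψ : Space d → ℝ := fun y => radialBump (((k : ℝ) + 1) • (y - x)) with hψ
    have hψ0 : ∀ y ∉ Metric.closedBall x (1 / ((k : ℝ) + 1)), ψ y = 0 := fun y hy =>
      radialBump_eq_zero (hout x y k hy)
    have h1 := ae_balance_law_of_test (ψ := ψ) hw hW hh heq hμ hμt
      (contDiff_radialBump.comp (g := radialBump) (f := fun y => ((k : ℝ) + 1) • (y - x))
        (by fun_prop))
      (HasCompactSupport.intro (isCompact_closedBall x _) hψ0)
      ((closure_minimal (Function.support_subset_iff'.2 hψ0)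
        Metric.isClosed_closedBall).trans hsub)
    filter_upwards [h1] with t ht
    rw [← ht]
    simp_rw [hψ, gradient_radialBump_comp]
  filter_upwards [hWm.prodMk_left, Measure.ae_ae_of_ae_prod hM, hh'.prod_right_ae, hdense]
    with t h1 h2 h3 h4
  refine ⟨h1, h2, h3, fun x k hsub => ?_⟩
  set s : ℝ := (k : ℝ) + 1 with hs
  obtain ⟨ε, hε, hthick⟩ := (isCompact_closedBall x (1 / s)).exists_cthickening_subset_open
    Ω.isOpen hsub
  rw [cthickening_closedBall hε.le (by positivity)] at hthick
  set K := Metric.closedBall x (ε + 1 / s)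
  have hKm : MeasurableSet K := Metric.isClosed_closedBall.measurableSet
  have hKc : IsCompact K := isCompact_closedBall _ _
  have hnear : ∀ x' ∈ Metric.ball x ε, Metric.closedBall x' (1 / s) ⊆ K := fun x' hx' =>
    Metric.closedBall_subset_closedBall' (by rw [Metric.mem_ball] at hx'; linarith)
  have hzero : ∀ x' ∈ Metric.ball x ε, ∀ y ∉ K, 1 ≤ ‖s • (y - x')‖ := fun x' hx' y hy =>
    hout x' y k fun h => hy (hnear x' hx' h)
  obtain ⟨C, hC⟩ := (continuous_radialBumpGrad (d := d)).bounded_above_of_compact_support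
    hasCompactSupport_radialBumpGrad
  have hgc := continuous_radialBumpGrad (d := d)
  have hbc := (contDiff_radialBump (d := d)).continuous
  have hball : ∀ᶠ x' in 𝓝[range (denseSeq (Space d))] x, x' ∈ Metric.ball x ε :=
    mem_nhdsWithin_of_mem_nhds (Metric.ball_mem_nhds x hε)
  have hne : (𝓝[range (denseSeq (Space d))] x).NeBot :=
    mem_closure_iff_nhdsWithin_neBot.1 (denseRange_denseSeq (Space d) x)
  have hlhs : Tendsto (fun x' => ∫ y in (Ω : Set (Space d)),
      (W t y (s • radialBumpGrad (s • (y - x'))) + radialBump (s • (y - x')) • h t y))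
      (𝓝[range (denseSeq (Space d))] x) (𝓝 (∫ y in (Ω : Set (Space d)),
      (W t y (s • radialBumpGrad (s • (y - x))) + radialBump (s • (y - x)) • h t y))) := by
    refine tendsto_integral_filter_of_dominated_convergence
      (fun y => K.indicator (fun _ => M * (s * C)) y + ‖h t y‖) ?_ ?_ ?_ ?_
    · refine Eventually.of_forall fun x' => ?_
      refine (aestronglyMeasurable_clm_apply h1 ?_).add (AEStronglyMeasurable.smul ?_ h3.1)
      · exact Continuous.aestronglyMeasurable (by fun_prop)
      · exact Continuous.aestronglyMeasurable (by fun_prop)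
    · filter_upwards [hball] with x' hx'
      filter_upwards [h2] with y hy
      refine (norm_add_le _ _).trans (add_le_add ?_ ?_)
      · by_cases hyK : y ∈ K
        · rw [indicator_of_mem hyK]
          refine (ContinuousLinearMap.le_of_opNorm_le _ hy _).trans
            (mul_le_mul_of_nonneg_left ?_ ((norm_nonneg _).trans hy))
          rw [norm_smul, Real.norm_of_nonneg (by positivity)]
          gcongr
          exact hC _
        · rw [indicator_of_notMem hyK, radialBumpGrad_eq_zero (hzero x' hx' y hyK)]
          simp
      · rw [norm_smul]
        exact mul_le_of_le_one_left (norm_nonneg _) (abs_radialBump_le _)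
    · refine Integrable.add ?_ h3.norm
      refine ((integrable_indicator_iff hKm).2 ?_).integrableOn
      exact integrableOn_const hKc.measure_lt_top.ne
    · refine Eventually.of_forall fun y => ?_
      have hcont : Continuous fun x' : Space d =>
          W t y (s • radialBumpGrad (s • (y - x'))) + radialBump (s • (y - x')) • h t y := by
        fun_prop
      exact hcont.continuousAt.tendsto.mono_left nhdsWithin_le_nhds
  have hrhs : Tendsto (fun x' => (μt t).integral fun y => radialBump (s • (y - x')))
      (𝓝[range (denseSeq (Space d))] x)
      (𝓝 ((μt t).integral fun y => radialBump (s • (y - x)))) := by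
    refine tendsto_integral_filter_of_dominated_convergence (K.indicator fun _ => (1 : ℝ))
      ?_ ?_ ?_ ?_
    · refine Eventually.of_forall fun x' => AEStronglyMeasurable.smul ?_
        (μt t).stronglyMeasurable_direction.aestronglyMeasurable
      exact Continuous.aestronglyMeasurable (by fun_prop)
    · filter_upwards [hball] with x' hx'
      filter_upwards [(μt t).norm_direction] with y hy
      rw [norm_smul, hy, mul_one]
      by_cases hyK : y ∈ K
      · rw [indicator_of_mem hyK]; exact abs_radialBump_le _
      · rw [indicator_of_notMem hyK, radialBump_eq_zero (hzero x' hx' y hyK), norm_zero]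
    · exact (integrable_indicator_iff hKm).2
        (integrableOn_const ((μt t).variation_lt_top K hKc hthick).ne)
    · refine Eventually.of_forall fun y => ?_
      have hcont : Continuous fun x' : Space d =>
          radialBump (s • (y - x')) • (μt t).direction y := by
        fun_prop
      exact hcont.continuousAt.tendsto.mono_left nhdsWithin_le_nhds
  refine tendsto_nhds_unique (hlhs.congr' ?_) hrhs
  filter_upwards [hball, self_mem_nhdsWithin] with x' hx' hmem
  obtain ⟨i, rfl⟩ := hmem
  exact h4 i k ((hnear _ hx').trans hthick)

end Slicing

/-! ### The isentropic Euler system -/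

section Euler

variable {d : ℕ} {T : ℝ} {Ω : Opens (Space d)}

/-- Almost every point of a Lipschitz hypersurface is a point of zero density of the source terms of
a balance law, so that the jump relation holds there for every normal direction. -/
theorem ae_jump_relation {F : Type*} [NormedAddCommGroup F] [NormedSpace ℝ F] [CompleteSpace F]
    (hd : 1 ≤ d) {W : Space d → Space d →L[ℝ] F} {h : Space d → F} {lam : RadonMeasure Ω F} {M : ℝ}
    (hW : AEStronglyMeasurable W (volume.restrict (Ω : Set (Space d))))
    (hWM : ∀ᵐ y ∂volume.restrict (Ω : Set (Space d)), ‖W y‖ ≤ M) (hh : IntegrableOn h Ω)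
    (heq : ∀ (x : Space d) (k : ℕ), Metric.closedBall x (1 / ((k : ℝ) + 1)) ⊆ Ω →
      ∫ y in (Ω : Set (Space d)),
        (W y (((k : ℝ) + 1) • radialBumpGrad (((k : ℝ) + 1) • (y - x)))
          + radialBump (((k : ℝ) + 1) • (y - x)) • h y) =
        lam.integral fun y => radialBump (((k : ℝ) + 1) • (y - x)))
    {S : Set (Space d)} (hSΩ : S ⊆ Ω) (hS : IsLipschitzHypersurface S)
    (hlam : lam.variation S = 0) :
    ∀ᵐ x ∂surfaceMeasure d, x ∈ S → ∀ n : Space d, ‖n‖ = 1 → ∀ Wp Wm : Space d →L[ℝ] F,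
      HasOneSidedLimits W x n Wp Wm → Wp n = Wm n := by
  have hs : (0 : ℝ) ≤ (d : ℝ) - 1 := by
    have : (1 : ℝ) ≤ d := by exact_mod_cast hd
    linarith
  set m := (volume.restrict (Ω : Set (Space d))).withDensity fun y => ‖h y‖ₑ
  have hm : m univ < ∞ := by
    rw [withDensity_apply _ MeasurableSet.univ, Measure.restrict_univ]
    exact hh.2
  have hmS : m S = 0 := withDensity_absolutelyContinuous _ _
    (Measure.restrict_le_self.absolutelyContinuous hS.volume_eq_zero)
  filter_upwards [ae_tendsto_density_zero lam.variation hs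
      (fun x hx => lam.exists_ball_lt_top (hSΩ hx)) hlam,
    ae_tendsto_density_zero m hs
      (fun x _ => ⟨1, one_pos, (measure_mono (subset_univ _)).trans_lt hm⟩) hmS]
    with x h1 h2 hxS n hn Wp Wm hbl
  exact jump_relation (hSΩ hxS) hn hW hWM hh (heq x) (h1 hxS) (h2 hxS) hbl

/-- The mass flux `e ↦ ρ ⟨u, e⟩` of the state `(ρ, u)`. -/
noncomputable def massFlux (s : ℝ × Space d) : Space d →L[ℝ] ℝ := s.1 • innerSL ℝ s.2

/-- The momentum flux `e ↦ ρ ⟨u, e⟩ u + p(ρ) e` of the state `(ρ, u)`. -/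
noncomputable def momentumFlux (p : ℝ → ℝ) (s : ℝ × Space d) : Space d →L[ℝ] Space d :=
  (massFlux s).smulRight s.2 + p s.1 • ContinuousLinearMap.id ℝ (Space d)

theorem continuous_massFlux : Continuous (massFlux (d := d)) :=
  continuous_fst.smul ((innerSL ℝ).continuous.comp continuous_snd)

theorem continuous_momentumFlux {p : ℝ → ℝ} (hp : Continuous p) :
    Continuous (momentumFlux (d := d) p) := by
  have h : Continuous fun s : ℝ × Space d => (massFlux s).smulRight s.2 :=
    ((ContinuousLinearMap.smulRightL ℝ (Space d) (Space d)).continuous₂).comp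
      (continuous_massFlux.prodMk continuous_snd)
  exact h.add ((hp.comp continuous_fst).smul continuous_const)

theorem memLp_top_continuous_comp {α F G : Type*} [MeasurableSpace α] {m : Measure α}
    [NormedAddCommGroup F] [ProperSpace F] [NormedAddCommGroup G] {g : α → F} (hg : MemLp g ∞ m)
    {Φ : F → G} (hΦ : Continuous Φ) : MemLp (fun y => Φ (g y)) ∞ m := by
  obtain ⟨M, hM⟩ := exists_ae_norm_le_of_memLp_top hg
  obtain ⟨B, hB⟩ := (isCompact_closedBall (0 : F) M).exists_bound_of_continuousOn hΦ.continuousOn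
  exact memLp_top_of_bound (hΦ.comp_aestronglyMeasurable hg.1) B
    (hM.mono fun y hy => hB _ (by simpa using hy))

theorem memLp_top_prodMk {α F G : Type*} [MeasurableSpace α] {m : Measure α}
    [NormedAddCommGroup F] [NormedAddCommGroup G] {g : α → F} {k : α → G} (hg : MemLp g ∞ m)
    (hk : MemLp k ∞ m) : MemLp (fun y => (g y, k y)) ∞ m := by
  obtain ⟨M, hM⟩ := exists_ae_norm_le_of_memLp_top hg
  obtain ⟨M', hM'⟩ := exists_ae_norm_le_of_memLp_top hk
  refine memLp_top_of_bound (hg.1.prodMk hk.1) (max M M') ?_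
  filter_upwards [hM, hM'] with y h1 h2
  exact max_le_max h1 h2

/-- The scalar relation between two states obtained from the continuity of the normal fluxes of mass
and of momentum, by taking the scalar product of the latter with the jump of the velocity. -/
theorem jump_mul_gam_eq_zero {p : ℝ → ℝ} {n up um : Space d} {ρp ρm : ℝ}
    (hmass : massFlux (ρp, up) n = massFlux (ρm, um) n)
    (hmom : momentumFlux p (ρp, up) n = momentumFlux p (ρm, um) n) :
    (⟪up, n⟫ - ⟪um, n⟫) * Gam p ρp ρm up um = 0 := by
  have h1 : ρp * ⟪up, n⟫ = ρm * ⟪um, n⟫ := by simpa [massFlux] using hmass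
  have h2 : (ρp * ⟪up, n⟫) • up + p ρp • n = (ρp * ⟪up, n⟫) • um + p ρm • n := by
    have h := hmom
    simp only [momentumFlux, massFlux, add_apply, smul_apply,
      ContinuousLinearMap.smulRight_apply, innerSL_apply_apply, smul_eq_mul,
      ContinuousLinearMap.id_apply] at h
    rwa [← h1] at h
  have h3 : (ρp * ⟪up, n⟫) * ‖up - um‖ ^ 2 + (p ρp - p ρm) * (⟪up, n⟫ - ⟪um, n⟫) = 0 := by
    have h4 : (ρp * ⟪up, n⟫) • (up - um) + (p ρp - p ρm) • n = 0 := by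
      rw [smul_sub, sub_smul, sub_add_sub_comm, h2, sub_self]
    have h5 := congrArg (fun v => ⟪up - um, v⟫) h4
    simp only [inner_add_right, real_inner_smul_right, inner_zero_right] at h5
    rw [real_inner_self_eq_norm_sq, inner_sub_left] at h5
    exact h5
  unfold Gam
  linear_combination (-(ρp - ρm)) * h3 + ‖up - um‖ ^ 2 * ρp * h1

end Euler
end IsentropicEuler

open IsentropicEuler in
theorem mainTheorem9 (d : ℕ) (hd : 1 ≤ d) (T : ℝ) (hT : 0 < T)
    (Ω : TopologicalSpace.Opens (IsentropicEuler.Space d))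
    (p : ℝ → ℝ) (hp : Continuous p) (hp0 : p 0 = 0)
    (ρ : ℝ → IsentropicEuler.Space d → ℝ)
    (u f : ℝ → IsentropicEuler.Space d → IsentropicEuler.Space d)
    (hsol : IsentropicEuler.IsBoundedWeakSolution T Ω p ρ u f)
    (μ : IsentropicEuler.RadonMeasure (IsentropicEuler.cylinder T Ω) ℝ)
    (ν : IsentropicEuler.RadonMeasure (IsentropicEuler.cylinder T Ω) (IsentropicEuler.Space d))
    (hμ : IsentropicEuler.IsTimeDerivative T Ω ρ μ)
    (hν : IsentropicEuler.IsTimeDerivative T Ω (fun t x => ρ t x • u t x) ν)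
    (μt : ℝ → IsentropicEuler.RadonMeasure Ω ℝ)
    (νt : ℝ → IsentropicEuler.RadonMeasure Ω (IsentropicEuler.Space d))
    (hμt : IsentropicEuler.DisintegratesInTime T Ω μ μt)
    (hνt : IsentropicEuler.DisintegratesInTime T Ω ν νt)
    (hnull : ∀ᵐ t ∂(MeasureTheory.volume.restrict (Set.Ioo 0 T)),
      ∀ S : Set (IsentropicEuler.Space d), S ⊆ Ω → IsentropicEuler.IsLipschitzHypersurface S →
        (μt t).VanishesOn S ∧ (νt t).VanishesOn S) :
    ∀ᵐ t ∂(MeasureTheory.volume.restrict (Set.Ioo 0 T)),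
      ∀ (S : Set (IsentropicEuler.Space d)) (n : IsentropicEuler.Space d → IsentropicEuler.Space d),
        S ⊆ Ω → IsentropicEuler.IsLipschitzHypersurface S → IsentropicEuler.IsUnitNormal S n →
        IsentropicEuler.HasBilateralTraces (ρ t) S →
        IsentropicEuler.HasBilateralTracesVec (u t) S →
        ∀ᵐ x ∂(IsentropicEuler.surfaceMeasure d), x ∈ S →
          (∃ (ρp ρm : ℝ) (up um : IsentropicEuler.Space d),
            IsentropicEuler.HasOneSidedLimits (ρ t) x (n x) ρp ρm ∧
            IsentropicEuler.HasOneSidedLimits (u t) x (n x) up um) ∧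
          ∀ (ρp ρm : ℝ) (up um : IsentropicEuler.Space d),
            IsentropicEuler.HasOneSidedLimits (ρ t) x (n x) ρp ρm →
            IsentropicEuler.HasOneSidedLimits (u t) x (n x) up um →
            (inner ℝ up (n x) - inner ℝ um (n x)) * IsentropicEuler.Gam p ρp ρm up um = 0 := by
  -- both equations are balance laws whose fluxes are continuous functions of the state `(ρ, u)`
  have hstate := memLp_top_prodMk hsol.density_memLp hsol.velocity_memLp
  have hmom : MemLp (fun q : ℝ × Space d => ρ q.1 q.2 • u q.1 q.2) ∞
      (volume.restrict (cylinder T Ω : Set (ℝ × Space d))) :=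
    memLp_top_continuous_comp hstate (Φ := fun s : ℝ × Space d => s.1 • s.2)
      (continuous_fst.smul continuous_snd)
  have hforce : IntegrableOn (fun q : ℝ × Space d => ρ q.1 q.2 • f q.1 q.2) (cylinder T Ω) := by
    obtain ⟨M, hM⟩ := exists_ae_norm_le_of_memLp_top hsol.density_memLp
    exact (memLp_one_iff_integrable.1 hsol.force_memLp).bdd_smul M hsol.density_memLp.1 hM
  obtain ⟨M₁, hslice₁⟩ := ae_balance_law_radialBump (w := ρ)
    (W := fun t x => massFlux (ρ t x, u t x)) (h := fun _ _ => 0) hsol.density_memLp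
    (memLp_top_continuous_comp hstate continuous_massFlux) integrableOn_zero
    (fun φ => by
      refine (integral_congr_ae (Eventually.of_forall fun q => ?_)).trans (hsol.continuity φ)
      simp [massFlux, mul_comm]) hμ hμt
  obtain ⟨M₂, hslice₂⟩ := ae_balance_law_radialBump (w := fun t x => ρ t x • u t x)
    (W := fun t x => momentumFlux p (ρ t x, u t x)) (h := fun t x => ρ t x • f t x) hmom
    (memLp_top_continuous_comp hstate (continuous_momentumFlux hp)) hforce
    (fun φ => by
      refine (integral_congr_ae (Eventually.of_forall fun q => ?_)).trans (hsol.momentum φ)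
      simp [momentumFlux, massFlux, smul_smul, add_assoc]) hν hνt
  obtain ⟨M, hM⟩ := exists_ae_norm_le_of_memLp_top hstate
  have hρm := hsol.density_memLp.1
  have hum := hsol.velocity_memLp.1
  rw [volume_restrict_cylinder] at hM hρm hum
  filter_upwards [hnull, hslice₁, hslice₂, Measure.ae_ae_of_ae_prod hM, hρm.prodMk_left,
    hum.prodMk_left] with t ht h₁ h₂ hMt hρt hut S n hSΩ hS hn hρS huS
  have hrel₁ := ae_jump_relation hd h₁.1 h₁.2.1 h₁.2.2.1 h₁.2.2.2 hSΩ hS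
    ((μt t).variation_eq_zero_of_vanishesOn (fun S' h h' => (ht S' h h').1) hSΩ hS)
  have hrel₂ := ae_jump_relation hd h₂.1 h₂.2.1 h₂.2.2.1 h₂.2.2.2 hSΩ hS
    ((νt t).variation_eq_zero_of_vanishesOn (fun S' h h' => (ht S' h h').2) hSΩ hS)
  have hui : ∀ i, AEStronglyMeasurable (fun y => u t y i) (volume.restrict (Ω : Set (Space d))) :=
    fun i => (EuclideanSpace.proj (𝕜 := ℝ) i).continuous.comp_aestronglyMeasurable hut
  filter_upwards [hn, hρS, huS, hrel₁, hrel₂, ae_exists_oneSidedLimits hρt hSΩ hS,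
    ae_all_iff.2 fun i => ae_exists_oneSidedLimits (hui i) hSΩ hS]
    with x hnx hρx hux hj₁ hj₂ hlimρ hlimu hxS
  obtain ⟨hn1, hno⟩ := hnx hxS
  refine ⟨?_, fun ρp ρm up um hρl hul => ?_⟩
  · obtain ⟨ρp, ρm, hρl⟩ := hlimρ hxS (n x) hn1 hno (hρx hxS)
    choose a b hab using fun i => hlimu i hxS (n x) hn1 hno (hux hxS i)
    exact ⟨ρp, ρm, WithLp.toLp 2 a, WithLp.toLp 2 b, hρl,
      HasOneSidedLimits.of_components hut (hSΩ hxS) hab⟩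
  · have hpair := hρl.prodMk hρt (hSΩ hxS) hul
    exact jump_mul_gam_eq_zero
      (hj₁ hxS (n x) hn1 _ _ (hpair.continuous_comp continuous_massFlux hMt (hSΩ hxS)))
      (hj₂ hxS (n x) hn1 _ _ (hpair.continuous_comp (continuous_momentumFlux hp) hMt (hSΩ hxS)))
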